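/- **Model.** A multiple access channel connects $n$ stations with names $0,\dots,n-1$ and works in synchronous rounds $0,1,2,\dots$. In a round each station is switched on or off. A switched-on station may transmit a message, which consists of at most one packet of its queue and a string of control bits. If exactly one station transmits, then all switched-on stations hear the message; otherwise nothing is heard. A station that is off neither transmits nor hears; when it switches off it fixes the round in which it is on again. Packets, each with a destination, are injected by an adversary of type $(\rho,\beta)$, $0<\rho\le 1$, $\beta\ge 1$: in any $\ell$ consecutive rounds at most $\rho\ell+\beta$ packets are injected, into any stations (on or off) and with any destinations. A packet is delivered in a round in which it is heard on the channel while its destination is on; it then disappears. If a packet is heard but not delivered, another station that hears it may adopt it into its queue as a relay. A deterministic distributed routing algorithm knows $n$ but not $\rho,\beta$, and does not use packet contents. The delay of a packet is the number of the round of its delivery minus that of its injection; the latency of an execution is at most $D$ if each injected packet is delivered, exactly once, with delay at most $D$. An algorithm works with energy cap $k$ if at most $k$ stations are on in each round of each execution; it is plain-packet if each transmitted message is a packet without control bits; it routes directly if no station ever adopts a packet, and indirectly otherwise; it is universal if for all $\rho<1$ and $\beta$ (and the given $n$) the latency is bounded by one number over all executions against adversaries of type $(\rho,\beta)$. **Adjust-Window.**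 Let $\lg x=\lceil\log_2(x+1)\rceil$. Time is divided into consecutive windows; the first has size the least positive integer $L$ with $L-9n^3\lg L\ge L/2$. In a window of size $L$, a packet is old if it was injected before the window or has been adopted by a station; only old packets are transmitted. A station is large if its queue at the beginning of the window has at least $4n\lg L$ packets, and small otherwise. A window has three stages. A transmitter removes from its queue each packet that is heard, and a receiver adopts a packet heard that is not delivered. 1. *Gossip*, $L_G=n^2(2+3\lg L)$ rounds: one phase of $2+3\lg L$ rounds for each pair $(i,j)$, in lexicographic order, in which only $i$ and $j$ are on. For $i\ne j$, if $i$ is large, it conveys one bit per round to $j$, sending an old packet for $1$ (one with destination $j$ if it has any, otherwise any old one) and being silent for $0$. The bits are: a $1$; whether the queue of $i$ has more than $L$ packets; and the binary digits of the queue size of $i$, of the number of packets with destination $j$, and of the number of packets with destination less than $j$, each replaced by $L$ if it exceeds $L$, all measured at the beginning of the window. If $i$ is small or $i=j$, the phase is silent. 2. *Main*, $L_M=L-L_G-L_A$ rounds. If some large stations have more than $L$ packets, the one with the smallest name is the sender in all rounds. Otherwise, the large stations are senders one after another in the order of names, each for as many rounds as it had packets at the beginning of the window, until the stage ends. A sender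 serves the destinations in the order of names, each for as many rounds as it had packets to that destination at the beginning of the window, transmitting in each such round an old packet to that destination if it still has one. Only the sender and the destination that it serves are on. 3. *Auxiliary*, $L_A=8n^3\lg L$ rounds: $8n\lg L$ times, one round for each pair $(i,j)$, in which only $i$ and $j$ are on and $i$ transmits an old packet with destination $j$ if it has one. The next window has size $2L$ if some large station had more than $L$ packets at the beginning of the window, or if the large stations together had more than $L_M$ packets then; otherwise it has size $L$. **Theorem.** For every $n$, the algorithm Adjust-Window is plain-packet, works with energy cap $2$ and is universal; for $n\ge3$ it routes indirectly. Moreover, for all $0<\rho<1$ and $\beta\ge1$ there is $N$ such that for all $n\ge N$, in every execution of Adjust-Window on $n$ stations against an adversary of type $(\rho,\beta)$, the latency is at most $$\frac{18n^3\log_2^2 n+2\beta}{1-\rho}.$$ -/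

import Mathlib

/-! ## Routing on a multiple access channel with switched stations -/

namespace MAC

/-- A packet. The triple `(round, source, idx)` says that it is the `idx`-th packet injected into
station `source` in round `round`; it plays the role of the content of the packet and tells
different packets apart. -/
structure Packet (n : ℕ) where
  dest : Fin n
  round : ℕ
  source : Fin n
  idx : ℕ

/-- A packet in the queue of a station, with the round in which it came there and whether the
station adopted it as a relay (`true`) or the adversary injected it there (`false`). -/
structure Stored (n : ℕ) where
  packet : Packet n
  since : ℕ
  relayed : Bool

/-- What a routing algorithm may look at in a queued packet: everything but its content. -/
structure Label (n : ℕ) where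
  dest : Fin n
  since : ℕ
  relayed : Bool

def Stored.label {n : ℕ} (x : Stored n) : Label n := ⟨x.packet.dest, x.since, x.relayed⟩

/-- An order of a station to transmit: the queue position of the packet to be included in the
message (if any), and the control bits. -/
structure Transmission where
  pos : Option ℕ
  bits : List Bool

/-- A message: at most one packet, and a string of control bits. -/
structure Message (n : ℕ) where
  packet : Option (Packet n)
  bits : List Bool

/-- What a switched-on station learns from a message that it hears. -/
structure Feedback (n : ℕ) where
  dest : Option (Fin n)
  bits : List Bool

/-- What a switched-on station does at the end of a round. -/
structure Reaction (σ : Type) where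
  /-- the new local state -/
  state : σ
  /-- whether it removes a packet that it has transmitted, if it was heard but not delivered -/
  drop : Bool
  /-- whether it adopts a packet that it has heard from another station, if not delivered -/
  adopt : Bool

/-- A deterministic distributed routing algorithm for `n` stations. The functions of a station
depend on its name, its local state, the number of the current round and the labels of the packets
in its queue. The local state of a station that is switched off is frozen (see `Station.next`), so
`on` amounts to a timer which is set when the station switches off: the rounds in which it
is off, and the round in which it is on again, are determined at that moment. -/
structure RoutingAlgorithm (n : ℕ) where
  State : Type
  init : Fin n → State
  on : Fin n → State → ℕ → Bool
  transmit : Fin n → State → ℕ → List (Label n) → Option Transmission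
  react : Fin n → State → ℕ → List (Label n) → Option (Feedback n) → Reaction State

/-- The local state and the queue of a station. -/
structure Station (n : ℕ) (σ : Type) where
  state : σ
  queue : List (Stored n)

/-- An injection pattern: the destinations of the packets that the adversary injects in a round
into a station. -/
abbrev Injections (n : ℕ) := ℕ → Fin n → List (Fin n)

/-- The packets injected in round `t` into station `i`. -/
def injected {n : ℕ} (inj : Injections n) (t : ℕ) (i : Fin n) : List (Packet n) :=
  (inj t i).mapIdx fun k d => ⟨d, t, i, k⟩

/-- The leaky-bucket adversary of type `(ρ, β)`: at most `ρ * ℓ + β` packets are injected in any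
`ℓ` consecutive rounds. -/
def IsOfType {n : ℕ} (inj : Injections n) (ρ β : ℝ) : Prop :=
  ∀ s l : ℕ, ((∑ t ∈ Finset.Ico s (s + l), ∑ i, (inj t i).length : ℕ) : ℝ) ≤ ρ * l + β

/-- The message that is heard on the channel, with its transmitter: there is one if and only if
exactly one station transmits. -/
def heard {n : ℕ} (tx : Fin n → Option (Message n)) : Option (Fin n × Message n) :=
  match (List.finRange n).filterMap fun i => (tx i).map fun m => (i, m) with
  | [x] => some x
  | _ => none

namespace RoutingAlgorithm

variable {n : ℕ} (A : RoutingAlgorithm n)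

/-- The message that station `i` transmits in round `t`, if any. -/
def message (t : ℕ) (i : Fin n) (s : Station n A.State) : Option (Message n) :=
  if A.on i s.state t then
    (A.transmit i s.state t (s.queue.map Stored.label)).map fun m =>
      ⟨(m.pos.bind fun k => s.queue[k]?).map Stored.packet, m.bits⟩
  else none

/-- The queue of station `i` after round `t`, before the packets injected in round `t` are added.
Here `h` is the message heard on the channel with its transmitter, `on` says which stations are
switched on, and `r` is the reaction of station `i`, which is assumed to be switched on. -/
def queueAfter (t : ℕ) (i : Fin n) (s : Station n A.State) (on : Fin n → Bool)
    (h : Option (Fin n × Message n)) (r : Reaction A.State) : List (Stored n) :=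
  match h with
  | some (k, ⟨some p, _⟩) =>
    if k = i then
      if on p.dest || r.drop then
        match (A.transmit i s.state t (s.queue.map Stored.label)).bind Transmission.pos with
        | some m => s.queue.eraseIdx m
        | none => s.queue
      else s.queue
    else
      if !on p.dest && r.adopt then s.queue ++ [⟨p, t, true⟩] else s.queue
  | _ => s.queue

/-- One round, `t`, of an execution. The packets injected in round `t` join the queues at the end
of the round. A station that is switched off keeps its local state. -/
def next (inj : Injections n) (t : ℕ) (c : Fin n → Station n A.State) :
    Fin n → Station n A.State :=
  let on : Fin n → Bool := fun i => A.on i (c i).state t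
  let h := heard fun i => A.message t i (c i)
  fun i =>
    let new : List (Stored n) := (injected inj t i).map fun p => ⟨p, t, false⟩
    if on i then
      let r := A.react i (c i).state t ((c i).queue.map Stored.label)
        (h.map fun x => ⟨x.2.packet.map Packet.dest, x.2.bits⟩)
      ⟨r.state, A.queueAfter t i (c i) on h r ++ new⟩
    else ⟨(c i).state, (c i).queue ++ new⟩

/-- The configuration at the beginning of each round of the execution. -/
def run (inj : Injections n) : ℕ → Fin n → Station n A.State
  | 0 => fun i => ⟨A.init i, []⟩
  | t + 1 => A.next inj t (run inj t)

/-- Station `i` is switched on in round `t`. -/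
def IsOn (inj : Injections n) (t : ℕ) (i : Fin n) : Prop :=
  A.on i (A.run inj t i).state t = true

/-- Packet `p` is delivered in round `t`: a message with `p` is heard on the channel while the
destination of `p` is switched on. -/
def DeliveredAt (inj : Injections n) (p : Packet n) (t : ℕ) : Prop :=
  (∃ k m, heard (fun i => A.message t i (A.run inj t i)) = some (k, m) ∧ m.packet = some p) ∧
    A.IsOn inj t p.dest

/-- At most `k` stations are switched on in any round of any execution. -/
def WorksWithEnergyCap (k : ℕ) : Prop :=
  ∀ (inj : Injections n) (t : ℕ), {i | A.IsOn inj t i}.ncard ≤ k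

/-- Every transmitted message consists of a packet and nothing else. -/
def IsPlainPacket : Prop :=
  ∀ (inj : Injections n) (t : ℕ) (i : Fin n) (m : Message n),
    A.message t i (A.run inj t i) = some m → m.packet.isSome ∧ m.bits = []

/-- No station ever adopts a packet as a relay. -/
def RoutesDirectly : Prop :=
  ∀ (ρ β : ℝ) (inj : Injections n), 0 < ρ → ρ ≤ 1 → 1 ≤ β → IsOfType inj ρ β →
    ∀ (t : ℕ) (i : Fin n), ∀ x ∈ (A.run inj t i).queue, x.relayed = false

/-- Every injected packet is delivered exactly once, with delay at most `D`. -/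
def LatencyAtMost (inj : Injections n) (D : ℝ) : Prop :=
  ∀ (r : ℕ) (i : Fin n), ∀ p ∈ injected inj r i,
    ∃ t, (∀ t', A.DeliveredAt inj p t' ↔ t' = t) ∧ r ≤ t ∧ (t : ℝ) - r ≤ D

/-- Bounded latency against each adversary of injection rate less than 1. -/
def IsUniversal : Prop :=
  ∀ ρ β : ℝ, 0 < ρ → ρ < 1 → 1 ≤ β →
    ∃ D : ℝ, ∀ inj : Injections n, IsOfType inj ρ β → A.LatencyAtMost inj D

end RoutingAlgorithm

/-! ## The algorithm Adjust-Window -/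

namespace AdjustWindow

/-- `lg x = ⌈log₂ (x + 1)⌉`. -/
def lg (x : ℕ) : ℕ := Nat.clog 2 (x + 1)

/-- The number of rounds of a phase of a Gossip stage. -/
def phaseLen (L : ℕ) : ℕ := 2 + 3 * lg L

/-- The number of rounds of a Gossip stage. -/
def gossipLen (n L : ℕ) : ℕ := n ^ 2 * phaseLen L

/-- The number of rounds of an Auxiliary stage. -/
def auxLen (n L : ℕ) : ℕ := n ^ 2 * (8 * n * lg L)

/-- The number of rounds of a Main stage. -/
def mainLen (n L : ℕ) : ℕ := L - gossipLen n L - auxLen n L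

/-- The size of the first window. -/
noncomputable def initialLen (n : ℕ) : ℕ :=
  sInf {L : ℕ | 0 < L ∧ (L : ℝ) / 2 ≤ (L : ℝ) - 9 * (n : ℝ) ^ 3 * (lg L : ℝ)}

/-- A position in a window: round `b` of the `(i, j)`-phase of the Gossip stage, round `τ` of the
Main stage, or an `(i, j)`-round of the Auxiliary stage. -/
inductive Position (n : ℕ) where
  | gossip (i j : Fin n) (b : ℕ)
  | main (τ : ℕ)
  | aux (i j : Fin n)

/-- The position of round number `τ = 0, 1, …` of a window of size `L`. -/
def position {n : ℕ} (hn : 0 < n) (L τ : ℕ) : Position n :=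
  if τ < gossipLen n L then
    .gossip ⟨τ / phaseLen L / n % n, Nat.mod_lt _ hn⟩ ⟨τ / phaseLen L % n, Nat.mod_lt _ hn⟩
      (τ % phaseLen L)
  else if τ < gossipLen n L + mainLen n L then
    .main (τ - gossipLen n L)
  else
    .aux ⟨(τ - gossipLen n L - mainLen n L) / n % n, Nat.mod_lt _ hn⟩
      ⟨(τ - gossipLen n L - mainLen n L) % n, Nat.mod_lt _ hn⟩

/-- What a station `i` tells a station `j` about the queue of `i` at the beginning of the window:
whether `i` is large, whether the queue has more than `L` packets, and (capped at `L`) the size of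
the queue, the number of packets with destination `j` and the number of packets with
destinations smaller than `j`. -/
structure Report where
  large : Bool
  huge : Bool
  size : ℕ
  toMe : ℕ
  before : ℕ

/-- The report to station `j` of a station with `c d` packets for each destination `d`. -/
def reportOf {n : ℕ} (L : ℕ) (c : Fin n → ℕ) (j : Fin n) : Report where
  large := decide (4 * n * lg L ≤ ∑ d, c d)
  huge := decide (4 * n * lg L ≤ ∑ d, c d) && decide (L < ∑ d, c d)
  size := min (∑ d, c d) L
  toMe := min (c j) L
  before := min (∑ d with d < j, c d) L

/-- Coded transfer of a report: the bit sent in round `b` of a phase (a packet is sent iff it is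
`true`). A small station stays silent. -/
def Report.bit (L : ℕ) (r : Report) (b : ℕ) : Bool :=
  r.large &&
    if b = 0 then true
    else if b = 1 then r.huge
    else if b < 2 + lg L then r.size.testBit (b - 2)
    else if b < 2 + 2 * lg L then r.toMe.testBit (b - (2 + lg L))
    else r.before.testBit (b - (2 + 2 * lg L))

/-- The number with binary digits `f s, f (s + 1), …, f (s + lg L - 1)`, least significant first. -/
def number (L : ℕ) (f : ℕ → Bool) (s : ℕ) : ℕ :=
  ∑ k ∈ Finset.range (lg L), if f (s + k) then 2 ^ k else 0

/-- Decoding of the bits received in a phase. -/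
def Report.ofBits (L : ℕ) (f : ℕ → Bool) : Report where
  large := f 0
  huge := f 1
  size := number L f 2
  toMe := number L f (2 + lg L)
  before := number L f (2 + 2 * lg L)

/-- The local state of a station: the size `len` and the first round `start` of the current
window, the number `count d` of packets with destination `d` in its queue at the beginning of the
window, and the bit `bit i b` received in round `b` of the phase in which station `i` reports. -/
structure State (n : ℕ) where
  len : ℕ
  start : ℕ
  count : Fin n → ℕ
  bit : Fin n → ℕ → Bool

variable {n : ℕ}

/-- What station `k` knows about station `i`, at the end of the Gossip stage. -/
def report (k : Fin n) (s : State n) (i : Fin n) : Report :=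
  if i = k then reportOf s.len s.count k else Report.ofBits s.len (s.bit i)

/-- Some queue has more than `L` packets. -/
def someHuge (rep : Fin n → Report) : Bool := decide (∃ i, (rep i).huge = true)

/-- The size that counts for the Main stage; a small station counts as if it had no packets. -/
def Report.load (r : Report) : ℕ := if r.large then r.size else 0

/-- The size of the next window, as computed by station `k`. -/
def nextLen (k : Fin n) (s : State n) : ℕ :=
  if someHuge (report k s) || decide (mainLen n s.len < ∑ i, (report k s i).load)
  then 2 * s.len else s.len

/-- The stations that transmit in the Main stage. -/
def active (rep : Fin n → Report) (i : Fin n) : Bool :=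
  if someHuge rep then (rep i).huge && decide (∀ i' < i, (rep i').huge = false)
  else (rep i).large

/-- The first round of the Main stage in which station `i` transmits, if it is active: the active
stations transmit one after another in the order of names. -/
def blockStart (rep : Fin n → Report) (i : Fin n) : ℕ :=
  if someHuge rep then 0 else ∑ i' with i' < i, (rep i').load

/-- Round `τ` of the Main stage is given to the sender `i`. -/
def mainSender (rep : Fin n → Report) (i : Fin n) (τ : ℕ) : Bool :=
  active rep i && decide (blockStart rep i ≤ τ ∧ τ < blockStart rep i + (rep i).size)

/-- In round `τ` of the Main stage, the sender `i` serves the receiver to which it has made the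
report `r`: a sender serves the destinations in the order of names. -/
def serves (rep : Fin n → Report) (i : Fin n) (r : Report) (τ : ℕ) : Bool :=
  mainSender rep i τ &&
    decide (blockStart rep i + r.before ≤ τ ∧ τ < blockStart rep i + r.before + r.toMe)

/-- Station `k` is a receiver in round `τ` of the Main stage. -/
def mainReceiver (k : Fin n) (s : State n) (τ : ℕ) : Bool :=
  decide (∃ i, serves (report k s) i (report k s i) τ = true)

/-- The destination that station `k` serves in round `τ` of the Main stage. -/
def mainTarget (k : Fin n) (s : State n) (τ : ℕ) : Option (Fin n) :=
  (List.finRange n).find? fun d => serves (report k s) k (reportOf s.len s.count d) τ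

/-- The passage to the next window if round `t` belongs to it, before the packets are counted. -/
def roll (k : Fin n) (s : State n) (t : ℕ) : State n :=
  if s.start + s.len ≤ t then ⟨nextLen k s, s.start + s.len, fun _ => 0, fun _ _ => false⟩ else s

/-- Old packets, in a window that begins in round `start`: those that came to the station before
the window, and those it has adopted (only old packets are ever transmitted). -/
def isOld (start : ℕ) (x : Label n) : Bool := x.relayed || decide (x.since < start)

/-- The local state of a switched-on station `k` in round `t`. In the first round of a window in
which it is on, a station counts the packets that it had at the beginning of the window. -/
def refresh (k : Fin n) (s : State n) (t : ℕ) (q : List (Label n)) : State n :=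
  if s.start + s.len ≤ t then
    { roll k s t with
      count := fun d => q.countP fun x => isOld (s.start + s.len) x && decide (x.dest = d) }
  else s

/-- The queue position of the first old packet with destination `d`. -/
def firstTo (start : ℕ) (d : Fin n) (q : List (Label n)) : Option ℕ :=
  q.findIdx? fun x => isOld start x && decide (x.dest = d)

/-- The queue position of the first old packet with destination `d`, or of the first old packet if
there is none with destination `d`. -/
def firstPreferred (start : ℕ) (d : Fin n) (q : List (Label n)) : Option ℕ :=
  (firstTo start d q).or (q.findIdx? fun x => isOld start x)

/-- The stations switched on: in a Gossip phase `(i, j)` and in an Auxiliary round `(i, j)` the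
stations `i` and `j`, in a round of the Main stage its sender and its receiver. -/
def on (k : Fin n) (s₀ : State n) (t : ℕ) : Bool :=
  let s := roll k s₀ t
  match position k.pos s.len (t - s.start) with
  | .gossip i j _ => decide (k = i ∨ k = j)
  | .main τ => mainSender (report k s) k τ || mainReceiver k s τ
  | .aux i j => decide (k = i ∨ k = j)

/-- The queue position of the packet transmitted by station `k` in round `t`, if any. -/
def sendPos (k : Fin n) (s₀ : State n) (t : ℕ) (q : List (Label n)) : Option ℕ :=
  let s := refresh k s₀ t q
  match position k.pos s.len (t - s.start) with
  | .gossip i j b =>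
    if k = i ∧ i ≠ j ∧ (reportOf s.len s.count j).bit s.len b = true
    then firstPreferred s.start j q else none
  | .main τ => (mainTarget k s τ).bind fun d => firstTo s.start d q
  | .aux i j => if k = i then firstTo s.start j q else none

/-- The local state of station `k` after round `t`, in which it is switched on and has heard a
message or not: in a Gossip phase, the receiver notes the bit. -/
def stateAfter (k : Fin n) (s₀ : State n) (t : ℕ) (q : List (Label n)) (hears : Bool) : State n :=
  let s := refresh k s₀ t q
  match position k.pos s.len (t - s.start) with
  | .gossip i j b =>
    if k = j ∧ i ≠ j then
      { s with bit := Function.update s.bit i (Function.update (s.bit i) b hears) }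
    else s
  | _ => s

/-- Adjust-Window, with first window of size `L₀`. -/
def algorithm (n L₀ : ℕ) : RoutingAlgorithm n where
  State := State n
  init := fun _ => ⟨L₀, 0, fun _ => 0, fun _ _ => false⟩
  on := on
  transmit := fun k s t q => (sendPos k s t q).map fun m => ⟨some m, []⟩
  react := fun k s t q h => ⟨stateAfter k s t q h.isSome, true, true⟩

end AdjustWindow

/-- The algorithm Adjust-Window for `n` stations. -/
noncomputable def adjustWindow (n : ℕ) : RoutingAlgorithm n :=
  AdjustWindow.algorithm n (AdjustWindow.initialLen n)

end MAC

/-!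
Adjust-Window is analysed window by window. `canon` is the state that a station should have after
`τ` rounds of a window, and `Inv` says that it has it, up to the lazy update of the stations that
have not yet been on in this window. The invariant survives a round (`Inv.succ`) because each bit
of the Gossip stage gets through: a `1` is sent only by a station that began the window with at
least `4 * n * lg L` packets, which are more than the rounds of all its phases (`Inv.enough`,
`Inv.gossip_round`). Hence after the Gossip stage all stations compute the same schedule of the
Main stage and the same size of the next window (`Conveys`). So in each round nobody transmits, or
one station `a` transmits to one station `b` and no third one is on (`Hop`). This gives the energy
cap, and the conservation law `pool_succ`: a packet is in exactly one queue until it is delivered,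
exactly once.

A window is clean (`Clean`) if its size is kept for the next window. A clean window delivers all
packets that were queued at its beginning (`Inv.cnt_end_eq_zero`): the Main stage serves all that a
large station had at the beginning, so each station is left with at most `8 * n * lg L` old packets
for each destination, either those of a small station or adopted ones, and the Auxiliary stage has
this many rounds for each pair of stations.

The latency bound rests on the observation that, at the beginning `T` of a window of size `L`, all
queued packets were injected in the last `L` rounds (`IsWindow.le_round_add`). After a clean window
this is clear, and after any other one both the window size and the admissible age have grown by
`L`. Thus at most `ρ * L + β` packets are queued at that time, and the size is never doubled once
this is at most the length of the Main stage. That happens after a number of doublings of the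
initial size `L₀` that depends only on `ρ` and `β` (`exists_doublings`, `le_mainLen`), since the
Gossip and Auxiliary stages of the first window take at most two thirds of it, and this overhead
grows only logarithmically when the window is doubled. A packet is delivered in a window that begins
at most `L` rounds after its injection, so its delay is at most `2 * L`, hence at most
`2 * 2 ^ i * L₀`. As `L₀ = O(n ^ 3 * log n)`, this is below `18 * n ^ 3 * log₂ n ^ 2` for large `n`.
-/

namespace MAC

/-! ### The channel -/

theorem filterMap_eq_singleton {α γ : Type*} {f : α → Option γ} {a : α} {y : γ} (ha : f a = some y)
    (h : ∀ b, b ≠ a → f b = none) : ∀ l : List α, l.Nodup → a ∈ l → l.filterMap f = [y] := by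
  intro l
  induction l with
  | nil => simp
  | cons b l ih =>
    intro hl hmem
    rw [List.nodup_cons] at hl
    by_cases hb : b = a
    · subst hb
      rw [List.filterMap_cons_some ha]
      congr 1
      rw [List.filterMap_eq_nil_iff]
      intro c hc
      exact h c fun hcb => hl.1 (hcb ▸ hc)
    · rw [List.filterMap_cons_none (h b hb)]
      exact ih hl.2 (by simpa [Ne.symm hb] using hmem)

theorem heard_eq_none {n : ℕ} {tx : Fin n → Option (Message n)} (h : ∀ i, tx i = none) :
    heard tx = none := by
  have : (List.finRange n).filterMap (fun i => (tx i).map fun m => (i, m)) = [] := by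
    rw [List.filterMap_eq_nil_iff]; intro a _; simp [h a]
  simp [heard, this]

theorem heard_eq_some {n : ℕ} {tx : Fin n → Option (Message n)} {i : Fin n} {m : Message n}
    (hi : tx i = some m) (h : ∀ j, j ≠ i → tx j = none) : heard tx = some (i, m) := by
  have : (List.finRange n).filterMap (fun i => (tx i).map fun m => (i, m)) = [(i, m)] := by
    apply filterMap_eq_singleton (a := i) _ _ _ (List.nodup_finRange n) (List.mem_finRange i)
    · simp [hi]
    · intro b hb; simp [h b hb]
  simp [heard, this]

namespace AdjustWindow

/-! ### Rounds of an execution -/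

variable {n : ℕ} (L₀ : ℕ) (inj : Injections n)

/-- The local state and the queue of station `k` at the beginning of round `t`. -/
def conf (t : ℕ) (k : Fin n) : Station n (State n) := (algorithm n L₀).run inj t k

/-- What station `k` may look at in its queue at the beginning of round `t`. -/
def labels (t : ℕ) (k : Fin n) : List (Label n) := (conf L₀ inj t k).queue.map Stored.label

/-- Station `k` is switched on in round `t`. -/
abbrev Awake (t : ℕ) (k : Fin n) : Prop := on k (conf L₀ inj t k).state t = true

/-- The queue position from which station `k` transmits in round `t`, provided that it is on. -/
def outPos (t : ℕ) (k : Fin n) : Option ℕ :=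
  sendPos k (conf L₀ inj t k).state t (labels L₀ inj t k)

/-- The message heard in round `t`, with its transmitter. -/
def heardAt (t : ℕ) : Option (Fin n × Message n) :=
  heard fun i => (algorithm n L₀).message t i (conf L₀ inj t i)

/-- The packets that enter the queue of station `k` in round `t` by injection. -/
def fresh (t : ℕ) (k : Fin n) : List (Stored n) :=
  (injected inj t k).map fun p => ⟨p, t, false⟩

theorem conf_zero (k : Fin n) :
    conf L₀ inj 0 k = ⟨⟨L₀, 0, fun _ => 0, fun _ _ => false⟩, []⟩ := rfl

theorem message_eq (t : ℕ) (k : Fin n) :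
    (algorithm n L₀).message t k (conf L₀ inj t k) =
      if on k (conf L₀ inj t k).state t = true then
        (outPos L₀ inj t k).map fun m =>
          ⟨((conf L₀ inj t k).queue[m]?).map Stored.packet, []⟩
      else none := by
  unfold RoutingAlgorithm.message
  change (if on k (conf L₀ inj t k).state t = true then
    ((((outPos L₀ inj t k).map fun m => (⟨some m, []⟩ : Transmission))).map _) else none) = _
  rw [Option.map_map]
  rfl

/-- Nobody transmits in round `t`. -/
def Silent (t : ℕ) : Prop := ∀ k, Awake L₀ inj t k → outPos L₀ inj t k = none

/-- In round `t`, exactly the stations `a` and `b` are on and `a` transmits the packet `x` at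
position `m` of its queue; if `a = b`, then `a` is the destination. -/
structure Hop (t : ℕ) (a b : Fin n) (m : ℕ) (x : Stored n) : Prop where
  awake_iff : ∀ k, Awake L₀ inj t k ↔ k = a ∨ k = b
  out : outPos L₀ inj t a = some m
  silent : ∀ k, k ≠ a → Awake L₀ inj t k → outPos L₀ inj t k = none
  get : (conf L₀ inj t a).queue[m]? = some x
  dest_of_eq : a = b → x.packet.dest = a

variable {L₀ inj} {t : ℕ} {a b : Fin n} {m : ℕ} {x : Stored n}

theorem Silent.heardAt (h : Silent L₀ inj t) : heardAt L₀ inj t = none := by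
  apply heard_eq_none
  intro i
  rw [message_eq]
  split_ifs with hi
  · rw [h i hi]; rfl
  · rfl

theorem Hop.heardAt (h : Hop L₀ inj t a b m x) :
    heardAt L₀ inj t = some (a, ⟨some x.packet, []⟩) := by
  apply heard_eq_some
  · rw [message_eq, if_pos ((h.awake_iff a).2 (Or.inl rfl)), h.out]
    simp [h.get]
  · intro j hj
    rw [message_eq]
    split_ifs with hi
    · rw [h.silent j hj hi]; rfl
    · rfl

theorem conf_succ (t : ℕ) (k : Fin n) :
    conf L₀ inj (t + 1) k =
      if on k (conf L₀ inj t k).state t = true then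
        ⟨stateAfter k (conf L₀ inj t k).state t (labels L₀ inj t k) (heardAt L₀ inj t).isSome,
          (algorithm n L₀).queueAfter t k (conf L₀ inj t k)
            (fun i => on i (conf L₀ inj t i).state t) (heardAt L₀ inj t)
            ⟨stateAfter k (conf L₀ inj t k).state t (labels L₀ inj t k)
              (heardAt L₀ inj t).isSome, true, true⟩ ++ fresh inj t k⟩
      else ⟨(conf L₀ inj t k).state, (conf L₀ inj t k).queue ++ fresh inj t k⟩ := by
  have : ((heardAt L₀ inj t).map
    fun x => (⟨x.2.packet.map Packet.dest, x.2.bits⟩ : Feedback n)).isSome =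
      (heardAt L₀ inj t).isSome := by simp
  rw [← this]
  rfl

theorem state_succ_of_not_awake {k : Fin n} (h : ¬ Awake L₀ inj t k) :
    (conf L₀ inj (t + 1) k).state = (conf L₀ inj t k).state := by
  rw [conf_succ, if_neg h]

theorem queue_succ_of_not_awake {k : Fin n} (h : ¬ Awake L₀ inj t k) :
    (conf L₀ inj (t + 1) k).queue = (conf L₀ inj t k).queue ++ fresh inj t k := by
  rw [conf_succ, if_neg h]

theorem state_succ_of_awake {k : Fin n} (h : Awake L₀ inj t k) :
    (conf L₀ inj (t + 1) k).state =
      stateAfter k (conf L₀ inj t k).state t (labels L₀ inj t k) (heardAt L₀ inj t).isSome := by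
  rw [conf_succ, if_pos h]

theorem Silent.queue (h : Silent L₀ inj t) (k : Fin n) :
    (conf L₀ inj (t + 1) k).queue = (conf L₀ inj t k).queue ++ fresh inj t k := by
  rw [conf_succ, h.heardAt]
  split_ifs <;> rfl

theorem Hop.queue (h : Hop L₀ inj t a b m x) (k : Fin n) :
    (conf L₀ inj (t + 1) k).queue =
      (if k = a then (conf L₀ inj t k).queue.eraseIdx m
      else if k = b ∧ x.packet.dest ≠ a ∧ x.packet.dest ≠ b then
        (conf L₀ inj t k).queue ++ [⟨x.packet, t, true⟩]
      else (conf L₀ inj t k).queue) ++ fresh inj t k := by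
  have hout : ((algorithm n L₀).transmit a (conf L₀ inj t a).state t
      ((conf L₀ inj t a).queue.map Stored.label)).bind Transmission.pos = some m := by
    change ((outPos L₀ inj t a).map fun m => (⟨some m, []⟩ : Transmission)).bind
      Transmission.pos = some m
    rw [h.out]; rfl
  have hon : ∀ k, on k (conf L₀ inj t k).state t = true ↔ k = a ∨ k = b := h.awake_iff
  rw [conf_succ, h.heardAt]
  by_cases hka : k = a
  · subst hka
    rw [if_pos ((hon k).2 (Or.inl rfl))]
    simp only [RoutingAlgorithm.queueAfter, if_true, Bool.or_true]
    rw [hout]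
  · have hak : a ≠ k := Ne.symm hka
    by_cases hkb : k = b
    · subst hkb
      rw [if_pos ((hon k).2 (Or.inr rfl))]
      have hd := hon x.packet.dest
      by_cases hdd : x.packet.dest = a ∨ x.packet.dest = k
      · have h1 := hd.2 hdd
        have h2 : ¬ (x.packet.dest ≠ a ∧ x.packet.dest ≠ k) := by tauto
        simp [RoutingAlgorithm.queueAfter, hak, hka, h1, h2]
      · have h1 : on x.packet.dest (conf L₀ inj t x.packet.dest).state t = false := by
          rw [← Bool.not_eq_true, hd]; exact hdd
        push Not at hdd
        simp [RoutingAlgorithm.queueAfter, hak, hka, h1, hdd]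
    · rw [if_neg (by rw [hon]; tauto), if_neg hka, if_neg (by tauto)]

/-- The packet transmitted in round `t` is delivered iff its destination takes part. -/
theorem Hop.deliveredAt_iff (h : Hop L₀ inj t a b m x) (p : Packet n) :
    (algorithm n L₀).DeliveredAt inj p t ↔ x.packet = p ∧ (p.dest = a ∨ p.dest = b) := by
  have h1 : heard (fun i => (algorithm n L₀).message t i ((algorithm n L₀).run inj t i)) =
    some (a, ⟨some x.packet, []⟩) := h.heardAt
  have h2 : (algorithm n L₀).IsOn inj t p.dest ↔ _ := h.awake_iff p.dest
  unfold RoutingAlgorithm.DeliveredAt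
  rw [h1, h2]
  simp

theorem Silent.not_deliveredAt (h : Silent L₀ inj t) (p : Packet n) :
    ¬ (algorithm n L₀).DeliveredAt inj p t := by
  have h1 : heard (fun i => (algorithm n L₀).message t i ((algorithm n L₀).run inj t i)) =
    none := h.heardAt
  unfold RoutingAlgorithm.DeliveredAt
  rw [h1]
  simp

/-! ### Conservation of packets -/

variable (L₀ inj) in
/-- The packets that are in the queues at the beginning of round `t`. -/
def pool (t : ℕ) : Multiset (Packet n) :=
  ∑ k, (((conf L₀ inj t k).queue.map Stored.packet : List (Packet n)) : Multiset (Packet n))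

variable (inj) in
/-- The packets injected in round `t`. -/
def arrivals (t : ℕ) : Multiset (Packet n) :=
  ∑ k, ((injected inj t k : List (Packet n)) : Multiset (Packet n))

variable (L₀ inj) in
open Classical in
/-- The packet delivered in round `t`, if any, as a multiset with at most one element. -/
noncomputable def delivered (t : ℕ) : Multiset (Packet n) :=
  match heardAt L₀ inj t with
  | some (_, ⟨some p, _⟩) => if Awake L₀ inj t p.dest then {p} else 0
  | _ => 0

variable (L₀ inj) in
/-- In each round, nobody transmits or one station transmits to one other or to itself. -/
def Regular (t : ℕ) : Prop := Silent L₀ inj t ∨ ∃ a b m x, Hop L₀ inj t a b m x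

theorem mem_delivered (h : Regular L₀ inj t) (p : Packet n) :
    p ∈ delivered L₀ inj t ↔ (algorithm n L₀).DeliveredAt inj p t := by
  rcases h with h | ⟨a, b, m, x, h⟩
  · simp [delivered, h.heardAt, h.not_deliveredAt]
  · rw [h.deliveredAt_iff, delivered, h.heardAt]
    simp only [h.awake_iff]
    split_ifs with h1
    · rw [Multiset.mem_singleton]
      constructor
      · rintro rfl; exact ⟨rfl, h1⟩
      · rintro ⟨rfl, _⟩; rfl
    · simp only [Multiset.notMem_zero, false_iff]
      rintro ⟨rfl, h2⟩; exact h1 h2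

theorem map_packet_fresh (t : ℕ) (k : Fin n) :
    (fresh inj t k).map Stored.packet = injected inj t k := by
  simp [fresh, Function.comp_def]

theorem coe_eraseIdx_add {α : Type*} {l : List α} {m : ℕ} {x : α} (h : l[m]? = some x) :
    ((l.eraseIdx m : List α) : Multiset α) + {x} = (l : Multiset α) := by
  obtain ⟨hm, rfl⟩ := List.getElem?_eq_some_iff.1 h
  rw [add_comm, Multiset.singleton_add, Multiset.cons_coe, Multiset.coe_eq_coe]
  exact List.getElem_cons_eraseIdx_perm hm

/-- Conservation of packets: a round moves a packet, or delivers it. -/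
theorem pool_succ (h : Regular L₀ inj t) :
    pool L₀ inj (t + 1) + delivered L₀ inj t = pool L₀ inj t + arrivals inj t := by
  rcases h with h | ⟨a, b, m, x, h⟩
  · simp only [pool, arrivals, delivered, h.heardAt, h.queue, List.map_append, map_packet_fresh,
      ← Multiset.coe_add, Finset.sum_add_distrib, add_zero]
  · have hx : (((conf L₀ inj t a).queue.map Stored.packet).eraseIdx m : Multiset (Packet n))
        + {x.packet} = ((conf L₀ inj t a).queue.map Stored.packet : List (Packet n)) := by
      apply coe_eraseIdx_add
      simp [h.get]
    have key : ∀ k, (((conf L₀ inj (t + 1) k).queue.map Stored.packet : List (Packet n)) :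
        Multiset (Packet n)) + (if k = a then {x.packet} else 0) =
        ((conf L₀ inj t k).queue.map Stored.packet : List (Packet n)) +
        (injected inj t k : List (Packet n)) +
        (if k = b then if x.packet.dest ≠ a ∧ x.packet.dest ≠ b then {x.packet} else 0 else 0) := by
      intro k
      rw [h.queue, List.map_append, map_packet_fresh, ← Multiset.coe_add]
      by_cases hka : k = a
      · subst hka
        rw [if_pos rfl, if_pos rfl]
        have : (if k = b then if x.packet.dest ≠ k ∧ x.packet.dest ≠ b then
          ({x.packet} : Multiset (Packet n)) else 0 else 0) = 0 := by
          split_ifs with h1 h2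
          · exact absurd (h.dest_of_eq h1) h2.1
          · rfl
          · rfl
        rw [this, add_zero, ← hx, ← List.eraseIdx_map]
        abel
      · rw [if_neg hka, if_neg hka, add_zero]
        by_cases hkb : k = b
        · subst hkb
          by_cases hd : x.packet.dest ≠ a ∧ x.packet.dest ≠ k
          · simp only [true_and, if_pos hd, List.map_append, if_true, List.map_cons, List.map_nil,
              ← Multiset.coe_add, Multiset.coe_singleton]
            abel
          · simp only [true_and, if_neg hd, if_true, add_zero]
        · simp [hkb]
    have hs := Finset.sum_congr (s₁ := Finset.univ) rfl fun k _ => key k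
    simp only [Finset.sum_add_distrib, Finset.sum_ite_eq', Finset.mem_univ, if_true] at hs
    have hs' : pool L₀ inj (t + 1) + {x.packet} = pool L₀ inj t + arrivals inj t +
      (if x.packet.dest ≠ a ∧ x.packet.dest ≠ b then {x.packet} else 0) := hs
    rw [delivered, h.heardAt]
    simp only [h.awake_iff]
    by_cases hd : x.packet.dest ≠ a ∧ x.packet.dest ≠ b
    · rw [if_pos hd] at hs'
      rw [if_neg (by tauto), add_zero]
      exact add_right_cancel hs'
    · rw [if_neg hd, add_zero] at hs'
      rw [if_pos (by tauto), hs']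

theorem pool_zero : pool L₀ inj 0 = 0 := by
  simp [pool, conf_zero]

theorem mem_injected {p : Packet n} {k : Fin n} (h : p ∈ injected inj t k) :
    p.round = t ∧ p.source = k := by
  unfold injected at h
  rw [List.mem_mapIdx] at h
  obtain ⟨i, hi, rfl⟩ := h
  exact ⟨rfl, rfl⟩

theorem mem_arrivals {p : Packet n} : p ∈ arrivals inj t ↔ ∃ k, p ∈ injected inj t k := by
  simp [arrivals, Multiset.mem_sum]

theorem round_of_mem_arrivals {p : Packet n} (h : p ∈ arrivals inj t) : p.round = t := by
  obtain ⟨k, hk⟩ := mem_arrivals.1 h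
  exact (mem_injected hk).1

theorem card_arrivals (t : ℕ) : (arrivals inj t).card = ∑ k, (inj t k).length := by
  simp [arrivals, injected]

theorem nodup_injected (t : ℕ) (k : Fin n) : (injected inj t k).Nodup := by
  unfold injected
  rw [List.nodup_iff_injective_get]
  intro i j hij
  simp only [List.get_eq_getElem, List.getElem_mapIdx, Packet.mk.injEq] at hij
  exact Fin.ext hij.2.2.2

theorem nodup_arrivals (t : ℕ) : (arrivals inj t).Nodup := by
  classical
  rw [Multiset.nodup_iff_count_le_one]
  intro p
  rw [arrivals, Multiset.count_sum']
  calc _ ≤ ∑ k, if k = p.source then 1 else 0 := by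
        apply Finset.sum_le_sum
        intro k _
        split_ifs with hk
        · exact Multiset.nodup_iff_count_le_one.1 (Multiset.coe_nodup.2 (nodup_injected t k)) p
        · rw [Nat.le_zero, Multiset.count_eq_zero]
          intro hp
          exact hk (mem_injected hp).2.symm
    _ = 1 := by simp

theorem nodup_sum_arrivals (t : ℕ) : (∑ r ∈ Finset.range t, arrivals inj r).Nodup := by
  classical
  rw [Multiset.nodup_iff_count_le_one]
  intro p
  rw [Multiset.count_sum']
  calc _ ≤ ∑ r ∈ Finset.range t, if r = p.round then 1 else 0 := by
        apply Finset.sum_le_sum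
        intro r _
        split_ifs with hk
        · exact Multiset.nodup_iff_count_le_one.1 (nodup_arrivals r) p
        · rw [Nat.le_zero, Multiset.count_eq_zero]
          intro hp
          exact hk (round_of_mem_arrivals hp).symm
    _ ≤ 1 := by
        rw [Finset.sum_ite_eq']
        split_ifs <;> simp

theorem pool_add_sum_delivered (h : ∀ t, Regular L₀ inj t) (t : ℕ) :
    pool L₀ inj t + ∑ r ∈ Finset.range t, delivered L₀ inj r =
      ∑ r ∈ Finset.range t, arrivals inj r := by
  induction t with
  | zero => simp [pool_zero]
  | succ t ih =>
    rw [Finset.sum_range_succ, Finset.sum_range_succ, ← ih, add_comm (∑ r ∈ _, _) (delivered _ _ _),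
      ← add_assoc, pool_succ (h t)]
    abel

/-- A packet that is queued in round `t` has been queued ever since its injection. -/
theorem mem_pool_mono (h : ∀ t, Regular L₀ inj t) {p : Packet n} {s : ℕ} (hp : p.round < s)
    (hst : s ≤ t) (hpt : p ∈ pool L₀ inj t) : p ∈ pool L₀ inj s := by
  induction t, hst using Nat.le_induction with
  | base => exact hpt
  | succ t hst ih =>
    apply ih
    have h1 : p ∈ pool L₀ inj t + arrivals inj t := by
      rw [← pool_succ (h t)]; exact Multiset.mem_add.2 (Or.inl hpt)
    rcases Multiset.mem_add.1 h1 with h2 | h2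
    · exact h2
    · have := round_of_mem_arrivals h2
      omega

theorem mem_pool {p : Packet n} :
    p ∈ pool L₀ inj t ↔ ∃ k, ∃ x ∈ (conf L₀ inj t k).queue, x.packet = p := by
  simp [pool, Multiset.mem_sum]

theorem mem_pool_of_deliveredAt (h : Regular L₀ inj t) {p : Packet n}
    (hp : (algorithm n L₀).DeliveredAt inj p t) : p ∈ pool L₀ inj t := by
  rcases h with h | ⟨a, b, m, x, h⟩
  · exact absurd hp (h.not_deliveredAt p)
  · exact mem_pool.2 ⟨a, x, List.mem_of_getElem? h.get, ((h.deliveredAt_iff p).1 hp).1⟩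

theorem mem_arrivals_of_mem_pool (h : ∀ t, Regular L₀ inj t) {p : Packet n}
    (hp : p ∈ pool L₀ inj t) : p.round < t ∧ p ∈ arrivals inj p.round := by
  have h1 : p ∈ ∑ r ∈ Finset.range t, arrivals inj r := by
    rw [← pool_add_sum_delivered h]; exact Multiset.mem_add.2 (Or.inl hp)
  rw [Multiset.mem_sum] at h1
  obtain ⟨r, hr, hpr⟩ := h1
  have := round_of_mem_arrivals hpr
  subst this
  exact ⟨Finset.mem_range.1 hr, hpr⟩

theorem pool_le_sum_arrivals (h : ∀ t, Regular L₀ inj t) {s : ℕ}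
    (hs : ∀ p ∈ pool L₀ inj t, s ≤ p.round) :
    pool L₀ inj t ≤ ∑ r ∈ Finset.Ico s t, arrivals inj r := by
  classical
  have hle : pool L₀ inj t ≤ ∑ r ∈ Finset.range t, arrivals inj r := by
    rw [← pool_add_sum_delivered h]; exact Multiset.le_add_right _ _
  have hnd : (pool L₀ inj t).Nodup := Multiset.nodup_of_le hle (nodup_sum_arrivals t)
  rw [Multiset.le_iff_subset hnd]
  intro p hp
  have h1 := mem_arrivals_of_mem_pool h hp
  rw [Multiset.mem_sum]
  exact ⟨p.round, Finset.mem_Ico.2 ⟨hs p hp, h1.1⟩, h1.2⟩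

/-- No packet is delivered twice, since all injected packets are different. -/
theorem deliveredAt_unique (h : ∀ t, Regular L₀ inj t) {p : Packet n} {s : ℕ}
    (hs : (algorithm n L₀).DeliveredAt inj p s) (ht : (algorithm n L₀).DeliveredAt inj p t) :
    s = t := by
  classical
  rw [← mem_delivered (h s)] at hs
  rw [← mem_delivered (h t)] at ht
  by_contra hst
  set u := max s t + 1
  have hle : ∑ r ∈ Finset.range u, delivered L₀ inj r ≤ ∑ r ∈ Finset.range u, arrivals inj r := by
    rw [← pool_add_sum_delivered h]; exact Multiset.le_add_left _ _
  have h1 := Multiset.nodup_iff_count_le_one.1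
    (Multiset.nodup_of_le hle (nodup_sum_arrivals u)) p
  rw [Multiset.count_sum'] at h1
  have h2 : ∑ r ∈ {s, t}, Multiset.count p (delivered L₀ inj r) ≤
      ∑ r ∈ Finset.range u, Multiset.count p (delivered L₀ inj r) := by
    apply Finset.sum_le_sum_of_subset
    intro r hr
    simp only [Finset.mem_insert, Finset.mem_singleton] at hr
    rw [Finset.mem_range]
    omega
  rw [Finset.sum_pair hst] at h2
  have h3 := Multiset.one_le_count_iff_mem.2 hs
  have h4 := Multiset.one_le_count_iff_mem.2 ht
  omega

/-- A packet that has left the queues has been delivered. -/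
theorem exists_deliveredAt (h : ∀ t, Regular L₀ inj t) {p : Packet n} {r : ℕ}
    (hp : p ∈ arrivals inj r) (hrt : r < t) (hpt : p ∉ pool L₀ inj t) :
    ∃ s, (algorithm n L₀).DeliveredAt inj p s := by
  have h1 : p ∈ pool L₀ inj t + ∑ r ∈ Finset.range t, delivered L₀ inj r := by
    rw [pool_add_sum_delivered h, Multiset.mem_sum]
    exact ⟨r, Finset.mem_range.2 hrt, hp⟩
  rcases Multiset.mem_add.1 h1 with h2 | h2
  · exact absurd h2 hpt
  · obtain ⟨s, _, hs⟩ := Multiset.mem_sum.1 h2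
    exact ⟨s, (mem_delivered (h s) p).1 hs⟩

end AdjustWindow

end MAC

namespace MAC.AdjustWindow

/-! ### The coded transfer of reports -/

theorem lt_two_pow_lg {x L : ℕ} (h : x ≤ L) : x < 2 ^ lg L :=
  lt_of_lt_of_le (Nat.lt_succ_of_le h) (Nat.le_pow_clog one_lt_two _)

theorem sum_testBit (x m : ℕ) :
    ∑ k ∈ Finset.range m, (if x.testBit k = true then 2 ^ k else 0) = x % 2 ^ m := by
  induction m with
  | zero => simp [Nat.mod_one]
  | succ m ih =>
    rw [Finset.sum_range_succ, ih, Nat.mod_pow_succ, Nat.testBit_eq_decide_div_mod_eq]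
    rcases Nat.mod_two_eq_zero_or_one (x / 2 ^ m) with h | h <;> simp [h]

theorem number_eq {L x s : ℕ} {f : ℕ → Bool} (hx : x ≤ L)
    (hf : ∀ k < lg L, f (s + k) = x.testBit k) : number L f s = x := by
  rw [number, ← Nat.mod_eq_of_lt (lt_two_pow_lg hx), ← sum_testBit]
  refine Finset.sum_congr rfl fun k hk => ?_
  rw [hf k (Finset.mem_range.1 hk)]

theorem number_eq_zero {L s : ℕ} {f : ℕ → Bool} (hf : ∀ k < lg L, f (s + k) = false) :
    number L f s = 0 := by
  apply number_eq (Nat.zero_le L)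
  intro k hk
  rw [hf k hk, Nat.zero_testBit]

/-- What a station learns from a report: everything if it comes from a large station, and nothing
from the silence of a small one. -/
def Report.conveyed (r : Report) : Report := if r.large then r else ⟨false, false, 0, 0, 0⟩

theorem ofBits_eq_conveyed {L : ℕ} {r : Report} {f : ℕ → Bool} (h1 : r.size ≤ L)
    (h2 : r.toMe ≤ L) (h3 : r.before ≤ L) (hf : ∀ b < phaseLen L, f b = r.bit L b) :
    Report.ofBits L f = r.conveyed := by
  unfold phaseLen at hf
  unfold Report.conveyed Report.ofBits
  by_cases hr : r.large = true
  · have e1 : number L f 2 = r.size := by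
      apply number_eq h1
      intro k hk
      rw [hf _ (by omega), Report.bit, hr, if_neg (by omega), if_neg (by omega),
        if_pos (by omega), Nat.add_sub_cancel_left, Bool.true_and]
    have e2 : number L f (2 + lg L) = r.toMe := by
      apply number_eq h2
      intro k hk
      rw [hf _ (by omega), Report.bit, hr, if_neg (by omega), if_neg (by omega),
        if_neg (by omega), if_pos (by omega), Nat.add_sub_cancel_left, Bool.true_and]
    have e3 : number L f (2 + 2 * lg L) = r.before := by
      apply number_eq h3
      intro k hk
      rw [hf _ (by omega), Report.bit, hr, if_neg (by omega), if_neg (by omega),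
        if_neg (by omega), if_neg (by omega), Nat.add_sub_cancel_left, Bool.true_and]
    have e4 : f 0 = r.large := by
      rw [hf _ (by omega)]; simp [Report.bit]
    have e5 : f 1 = r.huge := by
      rw [hf _ (by omega)]; simp [Report.bit, hr]
    rw [if_pos hr, e1, e2, e3, e4, e5]
  · have hz : ∀ b < 2 + 3 * lg L, f b = false := by
      intro b hb
      rw [hf b hb]
      simp [Report.bit, hr]
    rw [if_neg hr, hz 0 (by omega), hz 1 (by omega), number_eq_zero, number_eq_zero,
      number_eq_zero]
    all_goals
      intro k hk
      exact hz _ (by omega)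

/-! ### The schedule of the Main stage -/

variable {n : ℕ}

/-- The report of each station to itself; its parts that do not depend on the recipient of the
report determine which stations send in the Main stage, and when. -/
def own (L : ℕ) (c : Fin n → Fin n → ℕ) (i : Fin n) : Report := reportOf L (c i) i

/-- Station `i` is the sender in round `τ` of the Main stage of a window that begins with `c i d`
packets from `i` to `d`. -/
def sender (L : ℕ) (c : Fin n → Fin n → ℕ) (i : Fin n) (τ : ℕ) : Bool :=
  mainSender (own L c) i τ

/-- Station `i` serves `d` in round `τ` of the Main stage of a window that begins with `c i d`
packets from `i` to `d`. -/
def slot (L : ℕ) (c : Fin n → Fin n → ℕ) (i d : Fin n) (τ : ℕ) : Bool :=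
  serves (own L c) i (reportOf L (c i) d) τ

/-- The reports `rep` convey to station `k` what it has to know about the queue sizes `c`. -/
def Conveys (L : ℕ) (c : Fin n → Fin n → ℕ) (k : Fin n) (rep : Fin n → Report) : Prop :=
  ∀ i, rep i = reportOf L (c i) k ∨ rep i = (reportOf L (c i) k).conveyed

variable {L : ℕ} {c : Fin n → Fin n → ℕ} {k : Fin n} {rep : Fin n → Report}

theorem large_of_huge {i j : Fin n} (h : (reportOf L (c i) j).huge = true) :
    (reportOf L (c i) j).large = true := by
  simp only [reportOf, Bool.and_eq_true] at h ⊢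
  exact h.1

theorem Conveys.cases (h : Conveys L c k rep) (i : Fin n) :
    (rep i = reportOf L (c i) k) ∨
      (own L c i).large = false ∧ rep i = ⟨false, false, 0, 0, 0⟩ := by
  rcases h i with h | h
  · exact Or.inl h
  · unfold Report.conveyed at h
    split_ifs at h with hl
    · exact Or.inl h
    · exact Or.inr ⟨by simpa [own, reportOf] using hl, h⟩

theorem Conveys.large_eq (h : Conveys L c k rep) (i : Fin n) :
    (rep i).large = (own L c i).large := by
  rcases h.cases i with h | ⟨h1, h2⟩
  · rw [h]; rfl
  · rw [h1, h2]

theorem Conveys.huge_eq (h : Conveys L c k rep) (i : Fin n) :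
    (rep i).huge = (own L c i).huge := by
  rcases h.cases i with h | ⟨h1, h2⟩
  · rw [h]; rfl
  · have : (own L c i).huge = false := by
      rw [← Bool.not_eq_true]
      intro hh
      have := large_of_huge hh
      rw [own] at h1
      rw [this] at h1
      cases h1
    rw [this, h2]

theorem Conveys.load_eq (h : Conveys L c k rep) (i : Fin n) :
    (rep i).load = (own L c i).load := by
  rcases h.cases i with h | ⟨h1, h2⟩
  · rw [h]; rfl
  · simp [Report.load, h1, h2]

theorem Conveys.someHuge_eq (h : Conveys L c k rep) : someHuge rep = someHuge (own L c) := by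
  unfold someHuge
  simp only [h.huge_eq]

theorem Conveys.active_eq (h : Conveys L c k rep) (i : Fin n) :
    active rep i = active (own L c) i := by
  unfold active
  simp only [h.huge_eq, h.large_eq, h.someHuge_eq]

theorem Conveys.blockStart_eq (h : Conveys L c k rep) (i : Fin n) :
    blockStart rep i = blockStart (own L c) i := by
  unfold blockStart
  simp only [h.someHuge_eq, h.load_eq]

theorem large_of_active {i : Fin n} (h : active (own L c) i = true) :
    (own L c i).large = true := by
  unfold active at h
  split_ifs at h with h1
  · rw [Bool.and_eq_true] at h
    exact large_of_huge h.1
  · exact h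

theorem Conveys.eq_of_active (h : Conveys L c k rep) {i : Fin n}
    (hi : active (own L c) i = true) : rep i = reportOf L (c i) k := by
  rcases h.cases i with h | ⟨h1, h2⟩
  · exact h
  · rw [large_of_active hi] at h1; cases h1

theorem Conveys.mainSender_eq (h : Conveys L c k rep) (i : Fin n) (τ : ℕ) :
    mainSender rep i τ = sender L c i τ := by
  unfold sender mainSender
  rw [h.active_eq, h.blockStart_eq]
  by_cases hi : active (own L c) i = true
  · rw [h.eq_of_active hi]; rfl
  · simp [hi]

theorem Conveys.serves_eq (h : Conveys L c k rep) (i d : Fin n) (τ : ℕ) :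
    serves rep i (reportOf L (c i) d) τ = slot L c i d τ := by
  unfold slot serves
  rw [h.mainSender_eq, h.blockStart_eq, sender]

theorem Conveys.serves_self_eq (h : Conveys L c k rep) (i : Fin n) (τ : ℕ) :
    serves rep i (rep i) τ = slot L c i k τ := by
  rw [← h.serves_eq]
  unfold serves
  rw [h.mainSender_eq]
  by_cases hi : active (own L c) i = true
  · rw [h.eq_of_active hi]
  · simp [sender, mainSender, hi]

theorem sender_of_slot {i d : Fin n} {τ : ℕ} (h : slot L c i d τ = true) :
    sender L c i τ = true := by
  unfold slot serves at h
  rw [Bool.and_eq_true] at h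
  exact h.1

theorem sum_filter_lt_add_le (f : Fin n → ℕ) {i j : Fin n} (h : i < j) :
    ∑ k with k < i, f k + f i ≤ ∑ k with k < j, f k := by
  rw [add_comm, ← Finset.sum_insert (s := Finset.univ.filter (· < i)) (a := i) (by simp)]
  apply Finset.sum_le_sum_of_subset
  intro k
  simp only [Finset.mem_insert, Finset.mem_filter, Finset.mem_univ, true_and]
  rintro (rfl | hk)
  · exact h
  · exact hk.trans h

theorem sum_filter_lt_add_le_sum (f : Fin n → ℕ) (i : Fin n) :
    ∑ k with k < i, f k + f i ≤ ∑ k, f k := by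
  rw [add_comm, ← Finset.sum_insert (s := Finset.univ.filter (· < i)) (a := i) (by simp)]
  exact Finset.sum_le_sum_of_subset (Finset.subset_univ _)

theorem not_sender_of_lt {i j : Fin n} {τ : ℕ} (hij : i < j) (hi : sender L c i τ = true) :
    sender L c j τ ≠ true := by
  intro hj
  unfold sender mainSender at hi hj
  simp only [Bool.and_eq_true, decide_eq_true_eq] at hi hj
  have hli := large_of_active hi.1
  unfold active at hi hj
  unfold blockStart at hi hj
  by_cases hh : someHuge (own L c) = true
  · simp only [if_pos hh, Bool.and_eq_true, decide_eq_true_eq] at hi hj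
    have := hj.1.2 i hij
    rw [hi.1.1] at this
    cases this
  · simp only [if_neg hh] at hi hj
    have h1 := sum_filter_lt_add_le (fun k => (own L c k).load) hij
    have h2 : (own L c i).load = (own L c i).size := by simp [Report.load, hli]
    omega

theorem sender_unique {i j : Fin n} {τ : ℕ} (hi : sender L c i τ = true)
    (hj : sender L c j τ = true) : i = j := by
  rcases lt_trichotomy i j with h | h | h
  · exact absurd hj (not_sender_of_lt h hi)
  · exact h
  · exact absurd hi (not_sender_of_lt h hj)

theorem slot_iff {i d : Fin n} {τ : ℕ} : slot L c i d τ = true ↔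
    active (own L c) i = true ∧
    (blockStart (own L c) i ≤ τ ∧ τ < blockStart (own L c) i + min (∑ e, c i e) L) ∧
    (blockStart (own L c) i + min (∑ e with e < d, c i e) L ≤ τ ∧
      τ < blockStart (own L c) i + min (∑ e with e < d, c i e) L + min (c i d) L) := by
  unfold slot serves mainSender
  rw [Bool.and_eq_true, Bool.and_eq_true, decide_eq_true_iff, decide_eq_true_iff, and_assoc]
  rfl

theorem not_slot_of_lt {i d e : Fin n} {τ : ℕ} (hde : d < e) (hd : slot L c i d τ = true) :
    slot L c i e τ ≠ true := by
  intro he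
  rw [slot_iff] at hd he
  have := sum_filter_lt_add_le (c i) hde
  omega

theorem slot_unique {i d e : Fin n} {τ : ℕ} (hd : slot L c i d τ = true)
    (he : slot L c i e τ = true) : d = e := by
  rcases lt_trichotomy d e with h | h | h
  · exact absurd he (not_slot_of_lt h hd)
  · exact h
  · exact absurd hd (not_slot_of_lt h he)

/-- The packets of the large stations fit into the Main stage; otherwise the window size is
doubled. -/
def Clean (L : ℕ) (c : Fin n → Fin n → ℕ) : Prop :=
  someHuge (own L c) = false ∧ ∑ i, (own L c i).load ≤ mainLen n L

open Classical in
/-- The size of the next window. -/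
noncomputable def nextSize (L : ℕ) (c : Fin n → Fin n → ℕ) : ℕ :=
  if Clean L c then L else 2 * L

theorem Conveys.nextLen_eq {s : State n} (h : Conveys s.len c k (report k s)) :
    nextLen k s = nextSize s.len c := by
  unfold nextLen nextSize Clean
  simp only [h.someHuge_eq, h.load_eq]
  by_cases h1 : someHuge (own s.len c) = true
  · simp [h1]
  · by_cases h2 : mainLen n s.len < ∑ i, (own s.len c i).load
    · simp [h2, not_le.2 h2]
    · simp [h1, h2, not_lt.1 h2]

theorem Clean.sum_le {i : Fin n} (h : Clean L c) (hi : (own L c i).large = true) :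
    ∑ d, c i d ≤ L := by
  by_contra hL
  have h1 : ¬ ∃ i, (own L c i).huge = true := by simpa [someHuge] using h.1
  apply h1
  refine ⟨i, ?_⟩
  simp only [own, reportOf, decide_eq_true_eq, Bool.and_eq_true] at hi ⊢
  exact ⟨hi, not_le.1 hL⟩

theorem Clean.le_mainLen {i : Fin n} (h : Clean L c) (hi : (own L c i).large = true) (d : Fin n) :
    blockStart (own L c) i + ∑ e with e < d, c i e + c i d ≤ mainLen n L := by
  have h1 : (own L c i).load = ∑ e, c i e := by
    have := h.sum_le hi
    simp only [Report.load, hi, if_true]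
    exact min_eq_left this
  have h2 := sum_filter_lt_add_le_sum (fun i => (own L c i).load) i
  have h3 := sum_filter_lt_add_le_sum (c i) d
  have h4 : blockStart (own L c) i = ∑ k with k < i, (own L c k).load := by
    simp [blockStart, h.1]
  have h5 := h.2
  omega

theorem Clean.slot {i : Fin n} (h : Clean L c) (hi : (own L c i).large = true) {d : Fin n}
    {s : ℕ} (hs : s < c i d) :
    slot L c i d (blockStart (own L c) i + ∑ e with e < d, c i e + s) = true := by
  have h2 := h.sum_le hi
  have h3 := sum_filter_lt_add_le_sum (c i) d
  rw [slot_iff]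
  refine ⟨by simp [active, h.1, hi], ?_, ?_⟩ <;> omega

/-- If the window size is doubled, then the Main stage is too short for the queued packets. -/
theorem mainLen_lt_of_not_clean (h : ¬ Clean L c) : mainLen n L < ∑ i, ∑ d, c i d := by
  by_cases h1 : someHuge (own L c) = true
  · simp only [someHuge, decide_eq_true_eq] at h1
    obtain ⟨i, hi⟩ := h1
    simp only [own, reportOf, decide_eq_true_eq, Bool.and_eq_true] at hi
    have h2 := Finset.single_le_sum (f := fun i => ∑ d, c i d) (fun _ _ => Nat.zero_le _)
      (Finset.mem_univ i)
    unfold mainLen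
    omega
  · have h2 : mainLen n L < ∑ i, (own L c i).load := by
      by_contra h2
      exact h ⟨by simpa using h1, not_lt.1 h2⟩
    refine h2.trans_le (Finset.sum_le_sum fun i _ => ?_)
    unfold Report.load
    split_ifs
    · exact min_le_left _ _
    · exact Nat.zero_le _

/-! ### Positions in a window -/

theorem phaseLen_pos (L : ℕ) : 0 < phaseLen L := by unfold phaseLen; omega

theorem pair_lt (i j : Fin n) : i.1 * n + j.1 < n ^ 2 := by
  have hi := i.2
  have hj := j.2
  nlinarith

theorem gossip_lt (i j : Fin n) {b : ℕ} (hb : b < phaseLen L) :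
    (i.1 * n + j.1) * phaseLen L + b < gossipLen n L := by
  have h := pair_lt i j
  unfold gossipLen
  nlinarith

theorem gossip_decode (i j : Fin n) {b : ℕ} (hb : b < phaseLen L) :
    ((i.1 * n + j.1) * phaseLen L + b) / phaseLen L / n % n = i ∧
    ((i.1 * n + j.1) * phaseLen L + b) / phaseLen L % n = j ∧
    ((i.1 * n + j.1) * phaseLen L + b) % phaseLen L = b := by
  have h1 : ((i.1 * n + j.1) * phaseLen L + b) / phaseLen L = i.1 * n + j.1 := by
    rw [mul_comm, Nat.mul_add_div (phaseLen_pos L), Nat.div_eq_of_lt hb, add_zero]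
  have h2 : (i.1 * n + j.1) / n = i.1 := by
    rw [mul_comm, Nat.mul_add_div i.pos, Nat.div_eq_of_lt j.2, add_zero]
  refine ⟨?_, ?_, ?_⟩
  · rw [h1, h2, Nat.mod_eq_of_lt i.2]
  · rw [h1, mul_comm, Nat.mul_add_mod, Nat.mod_eq_of_lt j.2]
  · rw [mul_comm, Nat.mul_add_mod, Nat.mod_eq_of_lt hb]

theorem gossip_inj {i j i' j' : Fin n} {b b' : ℕ} (hb : b < phaseLen L) (hb' : b' < phaseLen L)
    (h : (i.1 * n + j.1) * phaseLen L + b = (i'.1 * n + j'.1) * phaseLen L + b') :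
    i = i' ∧ j = j' ∧ b = b' := by
  have h1 := gossip_decode i j hb
  have h2 := gossip_decode i' j' hb'
  rw [h] at h1
  exact ⟨Fin.ext (h1.1.symm.trans h2.1), Fin.ext (h1.2.1.symm.trans h2.2.1),
    h1.2.2.symm.trans h2.2.2⟩

theorem position_gossip (hn : 0 < n) (i j : Fin n) {b : ℕ} (hb : b < phaseLen L) :
    position hn L ((i.1 * n + j.1) * phaseLen L + b) = .gossip i j b := by
  obtain ⟨h1, h2, h3⟩ := gossip_decode i j hb
  rw [position, if_pos (gossip_lt i j hb)]
  congr 1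
  · exact Fin.ext h1
  · exact Fin.ext h2

theorem exists_gossip {τ : ℕ} (h : τ < gossipLen n L) :
    ∃ (i j : Fin n) (b : ℕ), b < phaseLen L ∧ τ = (i.1 * n + j.1) * phaseLen L + b := by
  have hP := phaseLen_pos L
  unfold gossipLen at h
  have h1 : τ / phaseLen L < n ^ 2 := by rwa [Nat.div_lt_iff_lt_mul hP]
  have hn : 0 < n := by
    rcases Nat.eq_zero_or_pos n with rfl | hn
    · simp at h1
    · exact hn
  have h2 : τ / phaseLen L / n < n := by
    rw [Nat.div_lt_iff_lt_mul hn]; rwa [pow_two] at h1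
  refine ⟨⟨_, h2⟩, ⟨τ / phaseLen L % n, Nat.mod_lt _ hn⟩, τ % phaseLen L, Nat.mod_lt _ hP, ?_⟩
  simp only
  rw [Nat.div_add_mod', Nat.div_add_mod']

theorem position_main (hn : 0 < n) {τ : ℕ} (h : τ < mainLen n L) :
    position hn L (gossipLen n L + τ) = .main τ := by
  rw [position, if_neg (by omega), if_pos (by omega), Nat.add_sub_cancel_left]

theorem position_aux (hn : 0 < n) (r : ℕ) (i j : Fin n) :
    position hn L (gossipLen n L + mainLen n L + (r * n ^ 2 + (i.1 * n + j.1))) = .aux i j := by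
  have h0 : r * n ^ 2 + (i.1 * n + j.1) = n * (n * r + i.1) + j.1 := by ring
  have h1 : (n * (n * r + i.1) + j.1) / n = n * r + i.1 := by
    rw [Nat.mul_add_div hn, Nat.div_eq_of_lt j.2, add_zero]
  have h2 : gossipLen n L + mainLen n L + (r * n ^ 2 + (i.1 * n + j.1)) - gossipLen n L -
      mainLen n L = n * (n * r + i.1) + j.1 := by omega
  rw [position, if_neg (by omega), if_neg (by omega)]
  simp only [h2]
  congr 1
  · apply Fin.ext
    simp only
    rw [h1, Nat.mul_add_mod, Nat.mod_eq_of_lt i.2]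
  · apply Fin.ext
    simp only
    rw [Nat.mul_add_mod, Nat.mod_eq_of_lt j.2]

theorem exists_aux (hn : 0 < n) (s : ℕ) :
    ∃ (r : ℕ) (i j : Fin n), s = r * n ^ 2 + (i.1 * n + j.1) := by
  have h1 : s % n ^ 2 / n < n := by
    rw [Nat.div_lt_iff_lt_mul hn, ← pow_two]
    exact Nat.mod_lt _ (by positivity)
  refine ⟨s / n ^ 2, ⟨_, h1⟩, ⟨s % n ^ 2 % n, Nat.mod_lt _ hn⟩, ?_⟩
  simp only
  rw [Nat.div_add_mod', Nat.div_add_mod']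

end MAC.AdjustWindow

namespace MAC.AdjustWindow

variable {n : ℕ}

/-! ### Window sizes -/

/-- A window of size `L` is long enough for its Gossip and Auxiliary stages. -/
def Fits (n L : ℕ) : Prop := 0 < L ∧ 18 * n ^ 3 * lg L ≤ L

theorem lg_two_mul_le (L : ℕ) : lg (2 * L) ≤ lg L + 1 := by
  unfold lg
  rw [Nat.clog_le_iff_le_pow one_lt_two, pow_succ]
  have := Nat.le_pow_clog one_lt_two (L + 1)
  omega

theorem lg_pos {L : ℕ} (hL : 0 < L) : 0 < lg L := Nat.clog_pos one_lt_two (by omega)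

theorem lg_mono {a b : ℕ} (h : a ≤ b) : lg a ≤ lg b := Nat.clog_mono_right 2 (by omega)

theorem Fits.two_mul {L : ℕ} (h : Fits n L) : Fits n (2 * L) := by
  refine ⟨by have := h.1; omega, ?_⟩
  have h1 := lg_two_mul_le L
  have h2 := lg_pos h.1
  calc 18 * n ^ 3 * lg (2 * L) ≤ 18 * n ^ 3 * (2 * lg L) := by gcongr; omega
    _ = 2 * (18 * n ^ 3 * lg L) := by ring
    _ ≤ 2 * L := by have := h.2; omega

theorem Fits.two_le_lg {L : ℕ} (h : Fits n L) (hn : 0 < n) : 2 ≤ lg L := by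
  have h2 := lg_pos h.1
  have h3 : 18 * 1 * 1 ≤ 18 * n ^ 3 * lg L := by gcongr; exacts [Nat.one_le_pow _ _ hn, h2]
  have h4 : lg 2 ≤ lg L := lg_mono (by have := h.2; omega)
  have h5 : 2 ^ 1 < 2 ^ lg 2 := lt_two_pow_lg le_rfl
  have h6 := (Nat.pow_lt_pow_iff_right (by norm_num)).1 h5
  omega

theorem Fits.mul_phaseLen_le {L : ℕ} (h : Fits n L) (hn : 0 < n) :
    n * phaseLen L ≤ 4 * n * lg L := by
  have := h.two_le_lg hn
  unfold phaseLen
  nlinarith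

theorem Fits.gossip_add_aux_le {L : ℕ} (h : Fits n L) (hn : 0 < n) :
    gossipLen n L + auxLen n L ≤ 12 * n ^ 3 * lg L := by
  have h1 := h.mul_phaseLen_le hn
  have h2 : gossipLen n L ≤ n * (4 * n * lg L) := by
    unfold gossipLen; rw [pow_two, mul_assoc]; gcongr
  have h3 : n * (4 * n * lg L) ≤ 4 * n ^ 3 * lg L := by
    have : n * (4 * n * lg L) * 1 ≤ n * (4 * n * lg L) * n := by gcongr; exact hn
    calc _ ≤ _ := by simpa using this
      _ = _ := by ring
  have h4 : auxLen n L = 8 * n ^ 3 * lg L := by unfold auxLen; ring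
  calc _ ≤ 4 * n ^ 3 * lg L + 8 * n ^ 3 * lg L := by omega
    _ = _ := by ring

theorem Fits.stages {L : ℕ} (h : Fits n L) (hn : 0 < n) :
    gossipLen n L + mainLen n L + auxLen n L = L := by
  have h1 := h.gossip_add_aux_le hn
  have h2 := h.2
  have h3 : 12 * n ^ 3 * lg L ≤ 18 * n ^ 3 * lg L := by gcongr; norm_num
  unfold mainLen
  omega

theorem Fits.nextSize {L : ℕ} (h : Fits n L) (c : Fin n → Fin n → ℕ) :
    Fits n (nextSize L c) := by
  unfold AdjustWindow.nextSize
  split_ifs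
  · exact h
  · exact h.two_mul

theorem exists_fits (n : ℕ) : ∃ L, Fits n L := by
  -- With `L = (2 ^ a) ^ 2`, where `lg L ≤ 2 * a + 1`.
  set a := 36 * n ^ 3 with ha
  have h1 : a + 1 ≤ 2 ^ a := Nat.lt_two_pow_self
  have h2 : lg (2 ^ (2 * a)) ≤ 2 * a + 1 := by
    unfold lg
    rw [Nat.clog_le_iff_le_pow one_lt_two, pow_succ]
    have := Nat.one_le_two_pow (n := 2 * a)
    omega
  refine ⟨2 ^ (2 * a), by positivity, ?_⟩
  calc 18 * n ^ 3 * lg (2 ^ (2 * a)) ≤ 18 * n ^ 3 * (2 * (a + 1)) := by gcongr; omega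
    _ = a * (a + 1) := by rw [ha]; ring
    _ ≤ 2 ^ a * 2 ^ a := by gcongr; omega
    _ = 2 ^ (2 * a) := by rw [two_mul, pow_add]

theorem initialLen_eq (n : ℕ) : initialLen n = sInf {L | Fits n L} := by
  unfold initialLen Fits
  congr 1
  ext L
  simp only [Set.mem_ofPred_eq, and_congr_right_iff]
  intro _
  rw [← Nat.cast_le (α := ℝ)]
  push_cast
  constructor <;> intro h <;> linarith

theorem fits_initialLen (n : ℕ) : Fits n (initialLen n) := by
  rw [initialLen_eq]
  exact Nat.sInf_mem (s := {L | Fits n L}) (exists_fits n)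

theorem initialLen_le {n L : ℕ} (h : Fits n L) : initialLen n ≤ L := by
  rw [initialLen_eq]
  exact Nat.sInf_le h

/-! ### Old packets -/

variable (L₀ : ℕ) (inj : Injections n)

/-- The number of packets in the queue of `k` with destination `d` that are old in a window that
begins in round `T`. -/
def cnt (T t : ℕ) (k d : Fin n) : ℕ :=
  (conf L₀ inj t k).queue.countP fun x => isOld T x.label && decide (x.packet.dest = d)

variable {L₀ inj} {T t : ℕ} {a b : Fin n} {m : ℕ} {x : Stored n}

theorem countP_labels (T t : ℕ) (k d : Fin n) :
    ((labels L₀ inj t k).countP fun x => isOld T x && decide (x.dest = d)) =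
      cnt L₀ inj T t k d := by
  unfold labels cnt
  rw [List.countP_map]
  rfl

theorem exists_of_findIdx?_eq_some {p : Label n → Bool} {k : Fin n}
    (h : (labels L₀ inj t k).findIdx? p = some m) :
    ∃ x, (conf L₀ inj t k).queue[m]? = some x ∧ p x.label = true := by
  rw [List.findIdx?_eq_some_iff_getElem] at h
  obtain ⟨hm, hp, _⟩ := h
  have hm' : m < (conf L₀ inj t k).queue.length := by simpa [labels] using hm
  refine ⟨(conf L₀ inj t k).queue[m], by simp [hm'], ?_⟩
  simpa [labels] using hp

theorem exists_of_firstTo {k d : Fin n} (h : firstTo T d (labels L₀ inj t k) = some m) :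
    ∃ x, (conf L₀ inj t k).queue[m]? = some x ∧ isOld T x.label = true ∧ x.packet.dest = d := by
  obtain ⟨x, h1, h2⟩ := exists_of_findIdx?_eq_some h
  rw [Bool.and_eq_true, decide_eq_true_eq] at h2
  exact ⟨x, h1, h2.1, h2.2⟩

theorem cnt_eq_zero_of_firstTo {k d : Fin n} (h : firstTo T d (labels L₀ inj t k) = none) :
    cnt L₀ inj T t k d = 0 := by
  rw [firstTo, List.findIdx?_eq_none_iff] at h
  rw [← countP_labels, List.countP_eq_zero]
  intro y hy
  rw [h y hy]
  exact Bool.false_ne_true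

theorem exists_of_firstPreferred {k d : Fin n} (h : 0 < ∑ e, cnt L₀ inj T t k e) :
    ∃ m x, firstPreferred T d (labels L₀ inj t k) = some m ∧
      (conf L₀ inj t k).queue[m]? = some x ∧ isOld T x.label = true := by
  unfold firstPreferred
  cases h1 : firstTo T d (labels L₀ inj t k) with
  | some m =>
    obtain ⟨x, hx⟩ := exists_of_firstTo h1
    exact ⟨m, x, rfl, hx.1, hx.2.1⟩
  | none =>
    cases h2 : (labels L₀ inj t k).findIdx? fun x => isOld T x with
    | some m =>
      obtain ⟨x, hx⟩ := exists_of_findIdx?_eq_some h2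
      exact ⟨m, x, rfl, hx⟩
    | none =>
      exfalso
      rw [List.findIdx?_eq_none_iff] at h2
      have h3 : ∀ e, cnt L₀ inj T t k e = 0 := by
        intro e
        rw [← countP_labels, List.countP_eq_zero]
        intro y hy
        rw [h2 y hy, Bool.false_and]
        exact Bool.false_ne_true
      simp [h3] at h

theorem countP_fresh (hT : T ≤ t) (k d : Fin n) :
    ((fresh inj t k).countP fun x => isOld T x.label && decide (x.packet.dest = d)) = 0 := by
  rw [List.countP_eq_zero]
  intro y hy
  unfold fresh at hy
  obtain ⟨p, _, rfl⟩ := List.mem_map.1 hy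
  simp only [isOld, Stored.label, Bool.false_or, Bool.and_eq_true, decide_eq_true_eq]
  exact fun h => absurd (of_decide_eq_true h.1) (not_lt.2 hT)

theorem Silent.cnt_succ (h : Silent L₀ inj t) (hT : T ≤ t) (k d : Fin n) :
    cnt L₀ inj T (t + 1) k d = cnt L₀ inj T t k d := by
  rw [cnt, h.queue, List.countP_append, countP_fresh hT, add_zero, cnt]

theorem countP_eraseIdx_add {α : Type*} {l : List α} (p : α → Bool) {x : α}
    (h : l[m]? = some x) : (l.eraseIdx m).countP p + (if p x then 1 else 0) = l.countP p := by
  obtain ⟨hm, rfl⟩ := List.getElem?_eq_some_iff.1 h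
  rw [← (List.getElem_cons_eraseIdx_perm hm).countP_eq, List.countP_cons]

theorem Hop.cnt_succ (h : Hop L₀ inj t a b m x) (hT : T ≤ t) (hx : isOld T x.label = true)
    (k d : Fin n) :
    cnt L₀ inj T (t + 1) k d + (if k = a ∧ x.packet.dest = d then 1 else 0) =
      cnt L₀ inj T t k d +
        (if k ≠ a ∧ k = b ∧ x.packet.dest ≠ a ∧ x.packet.dest ≠ b ∧ x.packet.dest = d
          then 1 else 0) := by
  rw [cnt, h.queue, List.countP_append, countP_fresh hT, add_zero, cnt]
  by_cases hka : k = a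
  · subst hka
    rw [← countP_eraseIdx_add (fun x => isOld T x.label && decide (x.packet.dest = d)) h.get]
    simp [hx]
  · by_cases hd : k = b ∧ x.packet.dest ≠ a ∧ x.packet.dest ≠ b
    · have ho : isOld T (Stored.label ⟨x.packet, t, true⟩) = true := rfl
      rw [if_neg hka, if_pos hd, List.countP_append]
      obtain ⟨rfl, hd⟩ := hd
      simp [hka, hd, ho]
    · rw [if_neg hka, if_neg hd, if_neg (by tauto), if_neg (by tauto)]

/-- In round `t`, station `i` serves `d`: only `i` and `d` are on, and `i` transmits an old
packet with destination `d` if it has one. -/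
def Serves (L₀ : ℕ) (inj : Injections n) (T t : ℕ) (i d : Fin n) : Prop :=
  (∀ k, Awake L₀ inj t k ↔ k = i ∨ k = d) ∧
    (Silent L₀ inj t ∧ cnt L₀ inj T t i d = 0 ∨
      ∃ m x, Hop L₀ inj t i d m x ∧ isOld T x.label = true ∧ x.packet.dest = d)

theorem Serves.cnt_le {i d : Fin n} (h : Serves L₀ inj T t i d) (hT : T ≤ t) (k e : Fin n) :
    cnt L₀ inj T (t + 1) k e ≤ cnt L₀ inj T t k e := by
  rcases h.2 with ⟨h, _⟩ | ⟨m, x, h, hx, hd⟩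
  · exact (h.cnt_succ hT k e).le
  · have := h.cnt_succ hT hx k e
    rw [if_neg (c := k ≠ i ∧ _) (by tauto)] at this
    omega

theorem Serves.cnt_le_sub_one {i d : Fin n} (h : Serves L₀ inj T t i d) (hT : T ≤ t) :
    cnt L₀ inj T (t + 1) i d ≤ cnt L₀ inj T t i d - 1 := by
  rcases h.2 with ⟨h, h0⟩ | ⟨m, x, h, hx, hd⟩
  · rw [h.cnt_succ hT, h0]
  · have := h.cnt_succ hT hx i d
    rw [if_neg (c := i ≠ i ∧ _) (by tauto), if_pos ⟨rfl, hd⟩] at this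
    omega

theorem Hop.sum_cnt_le (h : Hop L₀ inj t a b m x) (hT : T ≤ t) (hx : isOld T x.label = true)
    (k : Fin n) :
    ∑ d, cnt L₀ inj T t k d ≤ ∑ d, cnt L₀ inj T (t + 1) k d + (if k = a then 1 else 0) := by
  have h1 : ∑ d, cnt L₀ inj T t k d ≤
      ∑ d, (cnt L₀ inj T (t + 1) k d + (if k = a ∧ x.packet.dest = d then 1 else 0)) := by
    apply Finset.sum_le_sum
    intro d _
    rw [h.cnt_succ hT hx]
    exact Nat.le_add_right _ _
  rw [Finset.sum_add_distrib] at h1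
  refine h1.trans ?_
  gcongr
  split_ifs with hka
  · simp [hka]
  · simp [hka]

/-! ### The local states in a window -/

variable (n) in
/-- The state of station `k` after `τ` rounds of a window of size `L` that began in round `T`, with
`c i d` packets from `i` to `d`: it knows its own counts, and the bits received so far. -/
def canon (T L : ℕ) (c : Fin n → Fin n → ℕ) (k : Fin n) (τ : ℕ) : State n :=
  ⟨L, T, c k, fun i b => decide (i ≠ k ∧ (i.1 * n + k.1) * phaseLen L + b < τ ∧ b < phaseLen L) &&
    (reportOf L (c i) k).bit L b⟩

/-- The state of a station that is not addressed in a Gossip phase does not change. -/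
theorem canon_succ {T L : ℕ} {c : Fin n → Fin n → ℕ} {k : Fin n} {τ : ℕ}
    (h : ¬ ∃ (i : Fin n) (b : ℕ), i ≠ k ∧ b < phaseLen L ∧
      τ = (i.1 * n + k.1) * phaseLen L + b) : canon n T L c k (τ + 1) = canon n T L c k τ := by
  unfold canon
  congr
  funext i b
  congr 1
  rw [decide_eq_decide]
  constructor
  · rintro ⟨h1, h2, h3⟩
    refine ⟨h1, ?_, h3⟩
    rcases Nat.lt_succ_iff_lt_or_eq.1 h2 with h4 | h4
    · exact h4
    · exact absurd ⟨i, b, h1, h3, h4.symm⟩ h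
  · rintro ⟨h1, h2, h3⟩
    exact ⟨h1, by omega, h3⟩

theorem canon_succ_of_gossip {T L : ℕ} {c : Fin n → Fin n → ℕ} {i j : Fin n} {b : ℕ}
    (hij : i ≠ j) (hb : b < phaseLen L) :
    { canon n T L c j ((i.1 * n + j.1) * phaseLen L + b) with
      bit := Function.update (canon n T L c j ((i.1 * n + j.1) * phaseLen L + b)).bit i
        (Function.update ((canon n T L c j ((i.1 * n + j.1) * phaseLen L + b)).bit i) b
          ((reportOf L (c i) j).bit L b)) } =
    canon n T L c j ((i.1 * n + j.1) * phaseLen L + b + 1) := by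
  simp only [canon, State.mk.injEq, true_and]
  funext i' b'
  by_cases hi : i' = i
  · subst hi
    rw [Function.update_self]
    by_cases hbb : b' = b
    · subst hbb
      simp [hij, hb]
    · rw [Function.update_of_ne hbb]
      congr 1
      rw [decide_eq_decide]
      simp only [and_congr_right_iff, and_congr_left_iff]
      intros
      omega
  · rw [Function.update_of_ne hi]
    congr 1
    rw [decide_eq_decide]
    constructor
    · rintro ⟨h1, h2, h3⟩
      exact ⟨h1, by omega, h3⟩
    · rintro ⟨h1, h2, h3⟩
      refine ⟨h1, ?_, h3⟩
      rcases Nat.lt_succ_iff_lt_or_eq.1 h2 with h4 | h4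
      · exact h4
      · exact absurd (gossip_inj h3 hb h4).1 hi

theorem mul_phaseLen_lt_gossipLen (k : Fin n) (L : ℕ) : k.1 * phaseLen L < gossipLen n L := by
  have h1 := gossip_lt (L := L) ⟨0, k.pos⟩ k (phaseLen_pos L)
  simpa using h1

theorem report_canon {T L : ℕ} {c : Fin n → Fin n → ℕ} {k : Fin n} {τ : ℕ}
    (hτ : gossipLen n L ≤ τ) : Conveys L c k (report k (canon n T L c k τ)) := by
  intro i
  unfold report
  split_ifs with h
  · subst h; exact Or.inl rfl
  · refine Or.inr (ofBits_eq_conveyed (min_le_right _ _) (min_le_right _ _) (min_le_right _ _) ?_)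
    intro b (hb : b < phaseLen L)
    have := gossip_lt i k hb
    simp [canon, h, hb, this.trans_le hτ]

theorem roll_len (k : Fin n) (s : State n) (t : ℕ) (q : List (Label n)) :
    (roll k s t).len = (refresh k s t q).len := by
  unfold refresh
  split_ifs with h
  · rfl
  · rw [roll, if_neg h]

theorem roll_start (k : Fin n) (s : State n) (t : ℕ) (q : List (Label n)) :
    (roll k s t).start = (refresh k s t q).start := by
  unfold refresh
  split_ifs with h
  · rfl
  · rw [roll, if_neg h]

variable (L₀ inj) in
/-- The situation after `τ` rounds of a window of size `L` that began in round `T`: each station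
knows what it is supposed to know, and the sender of a Gossip phase has not yet lost so many
packets that it might have none to send. -/
structure Inv (T L τ : ℕ) : Prop where
  refresh_eq : τ < L → ∀ k, refresh k (conf L₀ inj (T + τ) k).state (T + τ)
    (labels L₀ inj (T + τ) k) = canon n T L (cnt L₀ inj T T) k τ
  state_eq : ∀ k : Fin n, k.1 * phaseLen L < τ →
    (conf L₀ inj (T + τ) k).state = canon n T L (cnt L₀ inj T T) k τ
  enough : τ ≤ gossipLen n L → ∀ i : Fin n, ∑ d, cnt L₀ inj T T i d ≤
    ∑ d, cnt L₀ inj T (T + τ) i d + (τ - i.1 * (n * phaseLen L))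

namespace Inv

variable {L τ : ℕ}

theorem position_roll (h : Inv L₀ inj T L τ) (hτ : τ < L) (k : Fin n) :
    position k.pos (roll k (conf L₀ inj (T + τ) k).state (T + τ)).len
      (T + τ - (roll k (conf L₀ inj (T + τ) k).state (T + τ)).start) = position k.pos L τ := by
  rw [roll_len _ _ _ (labels L₀ inj (T + τ) k), roll_start _ _ _ (labels L₀ inj (T + τ) k),
    h.refresh_eq hτ]
  simp [canon]

theorem awake_gossip (h : Inv L₀ inj T L τ) (hτ : τ < L) {i j : Fin n} {b : ℕ}
    (hb : b < phaseLen L) (hp : τ = (i.1 * n + j.1) * phaseLen L + b) (k : Fin n) :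
    Awake L₀ inj (T + τ) k ↔ k = i ∨ k = j := by
  have h1 := h.position_roll hτ k
  rw [hp, position_gossip k.pos i j hb, ← hp] at h1
  unfold Awake on
  simp only [h1, decide_eq_true_eq]

theorem outPos_gossip (h : Inv L₀ inj T L τ) (hτ : τ < L) {i j : Fin n} {b : ℕ}
    (hb : b < phaseLen L) (hp : τ = (i.1 * n + j.1) * phaseLen L + b) (k : Fin n) :
    outPos L₀ inj (T + τ) k =
      if k = i ∧ i ≠ j ∧ (reportOf L (cnt L₀ inj T T k) j).bit L b = true
      then firstPreferred T j (labels L₀ inj (T + τ) k) else none := by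
  have h2 : position k.pos L τ = .gossip i j b := by rw [hp, position_gossip k.pos i j hb]
  unfold outPos sendPos
  simp only [h.refresh_eq hτ, canon, Nat.add_sub_cancel_left, h2]

/-- In a Gossip phase, a `1` is always conveyed by a packet, since a large station has more packets
than there are rounds in its phases. -/
theorem gossip_round (h : Inv L₀ inj T L τ) (hL : Fits n L) (hτ : τ < L) {i j : Fin n} {b : ℕ}
    (hb : b < phaseLen L) (hp : τ = (i.1 * n + j.1) * phaseLen L + b) :
    if i ≠ j ∧ (reportOf L (cnt L₀ inj T T i) j).bit L b = true
    then ∃ m x, Hop L₀ inj (T + τ) i j m x ∧ isOld T x.label = true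
    else Silent L₀ inj (T + τ) := by
  split_ifs with hbit
  · have hlarge : 4 * n * lg L ≤ ∑ d, cnt L₀ inj T T i d := by
      have h1 := hbit.2
      simp only [Report.bit, Bool.and_eq_true] at h1
      simpa [reportOf] using h1.1
    have h1 := h.enough (by rw [hp]; exact (gossip_lt i j hb).le) i
    have h2 := hL.mul_phaseLen_le i.pos
    have h3 : τ - i.1 * (n * phaseLen L) < n * phaseLen L := by
      have : (j.1 + 1) * phaseLen L ≤ n * phaseLen L := by gcongr; exact j.2
      have h4 : τ = i.1 * (n * phaseLen L) + (j.1 * phaseLen L + b) := by rw [hp]; ring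
      rw [h4, Nat.add_sub_cancel_left]
      linarith
    obtain ⟨m, x, hm, hx, ho⟩ := exists_of_firstPreferred (d := j)
      (show 0 < ∑ d, cnt L₀ inj T (T + τ) i d by omega)
    refine ⟨m, x, ⟨h.awake_gossip hτ hb hp, ?_, ?_, hx, fun hij => absurd hij hbit.1⟩, ho⟩
    · rw [h.outPos_gossip hτ hb hp, if_pos ⟨rfl, hbit⟩, hm]
    · intro k hk _
      rw [h.outPos_gossip hτ hb hp, if_neg (by tauto)]
  · intro k _
    rw [h.outPos_gossip hτ hb hp, if_neg]
    rintro ⟨rfl, h1⟩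
    exact hbit h1

/-- The receiver of a Gossip phase notes the bit that the reporting station has meant. -/
theorem heardAt_gossip (h : Inv L₀ inj T L τ) (hL : Fits n L) (hτ : τ < L) {i j : Fin n} {b : ℕ}
    (hb : b < phaseLen L) (hp : τ = (i.1 * n + j.1) * phaseLen L + b) (hij : i ≠ j) :
    (heardAt L₀ inj (T + τ)).isSome = (reportOf L (cnt L₀ inj T T i) j).bit L b := by
  have h1 := h.gossip_round hL hτ hb hp
  split_ifs at h1 with hbit
  · obtain ⟨m, x, h1, _⟩ := h1
    rw [h1.heardAt, hbit.2]; rfl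
  · rw [h1.heardAt]
    have : ¬ (reportOf L (cnt L₀ inj T T i) j).bit L b = true := fun h2 => hbit ⟨hij, h2⟩
    rw [Bool.not_eq_true] at this
    rw [this]; rfl

theorem state_main (h : Inv L₀ inj T L τ) (hτ : gossipLen n L ≤ τ) (k : Fin n) :
    (conf L₀ inj (T + τ) k).state = canon n T L (cnt L₀ inj T T) k τ :=
  h.state_eq k ((mul_phaseLen_lt_gossipLen k L).trans_le hτ)

theorem awake_main {σ : ℕ} (h : Inv L₀ inj T L (gossipLen n L + σ)) (hL : Fits n L)
    (hσ : σ < mainLen n L) (k : Fin n) :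
    Awake L₀ inj (T + (gossipLen n L + σ)) k ↔ sender L (cnt L₀ inj T T) k σ = true ∨
      ∃ i, slot L (cnt L₀ inj T T) i k σ = true := by
  have hlt : gossipLen n L + σ < L := by have := hL.stages k.pos; omega
  have h1 := h.position_roll hlt k
  rw [position_main k.pos hσ] at h1
  have h2 := h.state_main (Nat.le_add_right _ _) k
  have h3 : roll k (conf L₀ inj (T + (gossipLen n L + σ)) k).state (T + (gossipLen n L + σ)) =
      canon n T L (cnt L₀ inj T T) k (gossipLen n L + σ) := by
    rw [h2, roll, if_neg]
    simp only [canon]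
    omega
  have h4 : Conveys L (cnt L₀ inj T T) k _ := report_canon (T := T) (Nat.le_add_right _ σ)
  rw [h3] at h1
  unfold Awake on
  simp only [h3, h1, Bool.or_eq_true, h4.mainSender_eq, mainReceiver, h4.serves_self_eq,
    decide_eq_true_eq]

theorem outPos_main {σ : ℕ} (h : Inv L₀ inj T L (gossipLen n L + σ)) (hL : Fits n L)
    (hσ : σ < mainLen n L) (k : Fin n) :
    outPos L₀ inj (T + (gossipLen n L + σ)) k =
      ((List.finRange n).find? fun d => slot L (cnt L₀ inj T T) k d σ).bind fun d =>
        firstTo T d (labels L₀ inj (T + (gossipLen n L + σ)) k) := by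
  have hlt : gossipLen n L + σ < L := by have := hL.stages k.pos; omega
  have h4 : Conveys L (cnt L₀ inj T T) k _ := report_canon (T := T) (Nat.le_add_right _ σ)
  have h5 : mainTarget k (canon n T L (cnt L₀ inj T T) k (gossipLen n L + σ)) σ =
      (List.finRange n).find? fun d => slot L (cnt L₀ inj T T) k d σ := by
    unfold mainTarget
    congr 1
    funext d
    exact h4.serves_eq k d σ
  have h6 : position k.pos (canon n T L (cnt L₀ inj T T) k (gossipLen n L + σ)).len
      (T + (gossipLen n L + σ) - (canon n T L (cnt L₀ inj T T) k (gossipLen n L + σ)).start) =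
      .main σ := by
    simp only [canon, Nat.add_sub_cancel_left]
    exact position_main k.pos hσ
  unfold outPos sendPos
  simp only [h.refresh_eq hlt, h6, h5]
  rfl

theorem main_round_slot {σ : ℕ} (h : Inv L₀ inj T L (gossipLen n L + σ)) (hL : Fits n L)
    (hσ : σ < mainLen n L) {i d : Fin n} (hs : slot L (cnt L₀ inj T T) i d σ = true) :
    Serves L₀ inj T (T + (gossipLen n L + σ)) i d := by
  have haw : ∀ k, Awake L₀ inj (T + (gossipLen n L + σ)) k ↔ k = i ∨ k = d := by
    intro k
    rw [h.awake_main hL hσ]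
    constructor
    · rintro (h1 | ⟨i', h1⟩)
      · exact Or.inl (sender_unique h1 (sender_of_slot hs))
      · have := sender_unique (sender_of_slot h1) (sender_of_slot hs)
        subst this
        exact Or.inr (slot_unique h1 hs)
    · rintro (rfl | rfl)
      · exact Or.inl (sender_of_slot hs)
      · exact Or.inr ⟨i, hs⟩
  have hsil : ∀ k, k ≠ i → outPos L₀ inj (T + (gossipLen n L + σ)) k = none := by
    intro k hk
    rw [h.outPos_main hL hσ]
    have : (List.finRange n).find? (fun d => slot L (cnt L₀ inj T T) k d σ) = none := by
      rw [List.find?_eq_none]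
      intro e _ he
      exact hk (sender_unique (sender_of_slot he) (sender_of_slot hs))
    rw [this]; rfl
  have hout : outPos L₀ inj (T + (gossipLen n L + σ)) i =
      firstTo T d (labels L₀ inj (T + (gossipLen n L + σ)) i) := by
    rw [h.outPos_main hL hσ]
    cases hf : (List.finRange n).find? (fun d => slot L (cnt L₀ inj T T) i d σ) with
    | none =>
      rw [List.find?_eq_none] at hf
      exact absurd hs (hf d (List.mem_finRange d))
    | some e =>
      have he := List.find?_some hf
      rw [slot_unique he hs]
      rfl
  refine ⟨haw, ?_⟩
  cases hf : firstTo T d (labels L₀ inj (T + (gossipLen n L + σ)) i) with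
  | none =>
    refine Or.inl ⟨?_, cnt_eq_zero_of_firstTo hf⟩
    intro k _
    by_cases hk : k = i
    · rw [hk, hout, hf]
    · exact hsil k hk
  | some m =>
    obtain ⟨x, hx, ho, hd⟩ := exists_of_firstTo hf
    refine Or.inr ⟨m, x, ⟨haw, by rw [hout, hf], fun k hk _ => hsil k hk, hx, ?_⟩, ho, hd⟩
    rintro rfl
    exact hd

theorem main_round_idle {σ : ℕ} (h : Inv L₀ inj T L (gossipLen n L + σ)) (hL : Fits n L)
    (hσ : σ < mainLen n L) (hs : ∀ i d, slot L (cnt L₀ inj T T) i d σ ≠ true) :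
    Silent L₀ inj (T + (gossipLen n L + σ)) ∧
      ∀ k k', Awake L₀ inj (T + (gossipLen n L + σ)) k →
        Awake L₀ inj (T + (gossipLen n L + σ)) k' → k = k' := by
  constructor
  · intro k _
    rw [h.outPos_main hL hσ]
    have : (List.finRange n).find? (fun d => slot L (cnt L₀ inj T T) k d σ) = none := by
      rw [List.find?_eq_none]
      intro e _
      exact hs k e
    rw [this]; rfl
  · intro k k' hk hk'
    rw [h.awake_main hL hσ] at hk hk'
    rcases hk with hk | ⟨i, hk⟩
    · rcases hk' with hk' | ⟨i, hk'⟩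
      · exact sender_unique hk hk'
      · exact absurd hk' (hs _ _)
    · exact absurd hk (hs _ _)

theorem aux_round {i j : Fin n} {r : ℕ}
    (h : Inv L₀ inj T L (gossipLen n L + mainLen n L + (r * n ^ 2 + (i.1 * n + j.1))))
    (hτ : gossipLen n L + mainLen n L + (r * n ^ 2 + (i.1 * n + j.1)) < L) :
    Serves L₀ inj T (T + (gossipLen n L + mainLen n L + (r * n ^ 2 + (i.1 * n + j.1)))) i j := by
  generalize hτ' : gossipLen n L + mainLen n L + (r * n ^ 2 + (i.1 * n + j.1)) = τ at h hτ ⊢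
  have hpos : ∀ k : Fin n, position k.pos L τ = .aux i j := fun k => by
    rw [← hτ', position_aux]
  have haw : ∀ k, Awake L₀ inj (T + τ) k ↔ k = i ∨ k = j := by
    intro k
    have h1 := h.position_roll hτ k
    rw [hpos k] at h1
    unfold Awake on
    simp only [h1, decide_eq_true_eq]
  have hout : ∀ k, outPos L₀ inj (T + τ) k =
      if k = i then firstTo T j (labels L₀ inj (T + τ) k) else none := by
    intro k
    unfold outPos sendPos
    simp only [h.refresh_eq hτ, canon, Nat.add_sub_cancel_left, hpos k]
  refine ⟨haw, ?_⟩
  cases hf : firstTo T j (labels L₀ inj (T + τ) i) with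
  | none =>
    refine Or.inl ⟨?_, cnt_eq_zero_of_firstTo hf⟩
    intro k _
    rw [hout]
    split_ifs with hk
    · rw [hk, hf]
    · rfl
  | some m =>
    obtain ⟨x, hx, ho, hd⟩ := exists_of_firstTo hf
    refine Or.inr ⟨m, x, ⟨haw, by rw [hout, if_pos rfl, hf], fun k hk _ => by
      rw [hout, if_neg hk], hx, ?_⟩, ho, hd⟩
    rintro rfl
    exact hd

/-- The three kinds of rounds of a window. -/
theorem round_cases (h : Inv L₀ inj T L τ) (hL : Fits n L) (hτ : τ < L) (hn : 0 < n) :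
    (∃ (i j : Fin n) (b : ℕ), b < phaseLen L ∧ τ = (i.1 * n + j.1) * phaseLen L + b) ∨
    gossipLen n L ≤ τ ∧ ((∃ i d, Serves L₀ inj T (T + τ) i d) ∨
      Silent L₀ inj (T + τ) ∧ ∀ k k', Awake L₀ inj (T + τ) k → Awake L₀ inj (T + τ) k' → k = k') := by
  rcases lt_or_ge τ (gossipLen n L) with h1 | h1
  · exact Or.inl (exists_gossip h1)
  · refine Or.inr ⟨h1, ?_⟩
    rcases lt_or_ge τ (gossipLen n L + mainLen n L) with h2 | h2
    · obtain ⟨σ, rfl⟩ := Nat.exists_eq_add_of_le h1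
      have hσ : σ < mainLen n L := by omega
      by_cases hs : ∃ i d, slot L (cnt L₀ inj T T) i d σ = true
      · obtain ⟨i, d, hs⟩ := hs
        exact Or.inl ⟨i, d, h.main_round_slot hL hσ hs⟩
      · push Not at hs
        exact Or.inr (h.main_round_idle hL hσ hs)
    · obtain ⟨σ, rfl⟩ := Nat.exists_eq_add_of_le h2
      obtain ⟨r, i, j, rfl⟩ := exists_aux hn σ
      exact Or.inl ⟨i, j, h.aux_round hτ⟩

theorem regular (h : Inv L₀ inj T L τ) (hL : Fits n L) (hτ : τ < L) (hn : 0 < n) :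
    Silent L₀ inj (T + τ) ∨ ∃ a b m x, Hop L₀ inj (T + τ) a b m x ∧ isOld T x.label = true := by
  rcases h.round_cases hL hτ hn with ⟨i, j, b, hb, hp⟩ | ⟨_, ⟨i, d, h1⟩ | h1⟩
  · have h1 := h.gossip_round hL hτ hb hp
    split_ifs at h1
    · obtain ⟨m, x, h1⟩ := h1
      exact Or.inr ⟨i, j, m, x, h1⟩
    · exact Or.inl h1
  · rcases h1.2 with h1 | ⟨m, x, h1⟩
    · exact Or.inl h1.1
    · exact Or.inr ⟨i, d, m, x, h1.1, h1.2.1⟩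
  · exact Or.inl h1.1

theorem awake_le_two (h : Inv L₀ inj T L τ) (hL : Fits n L) (hτ : τ < L) (hn : 0 < n) :
    ∃ a b, ∀ k, Awake L₀ inj (T + τ) k → k = a ∨ k = b := by
  rcases h.round_cases hL hτ hn with ⟨i, j, b, hb, hp⟩ | ⟨_, ⟨i, d, h1⟩ | h1⟩
  · exact ⟨i, j, fun k hk => (h.awake_gossip hτ hb hp k).1 hk⟩
  · exact ⟨i, d, fun k hk => (h1.1 k).1 hk⟩
  · by_cases h2 : ∃ k, Awake L₀ inj (T + τ) k
    · obtain ⟨a, ha⟩ := h2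
      exact ⟨a, a, fun k hk => Or.inl (h1.2 k a hk ha)⟩
    · exact ⟨⟨0, hn⟩, ⟨0, hn⟩, fun k hk => absurd ⟨k, hk⟩ h2⟩

/-- A station that counts its packets late counts those of the beginning of the window, since a
station that is off gets only packets that are not old. -/
theorem refresh_succ {k : Fin n} {s : State n} {t L : ℕ} (hT : T ≤ t) (ht : t + 1 < T + L)
    (hs : (refresh k s t (labels L₀ inj t k)).start = T)
    (hl : (refresh k s t (labels L₀ inj t k)).len = L)
    (hq : (conf L₀ inj (t + 1) k).queue = (conf L₀ inj t k).queue ++ fresh inj t k) :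
    refresh k s (t + 1) (labels L₀ inj (t + 1) k) = refresh k s t (labels L₀ inj t k) := by
  have hc : ∀ d, cnt L₀ inj T (t + 1) k d = cnt L₀ inj T t k d := by
    intro d
    rw [cnt, hq, List.countP_append, countP_fresh hT, add_zero, cnt]
  unfold refresh at hs hl ⊢
  by_cases h : s.start + s.len ≤ t
  · rw [if_pos h, roll, if_pos h] at hs
    simp only at hs
    rw [if_pos h, if_pos (by omega), roll, roll, if_pos h, if_pos (by omega)]
    simp only [hs, countP_labels, hc]
  · rw [if_neg h] at hs hl
    rw [if_neg h, if_neg (by omega)]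

theorem stateAfter_eq (h : Inv L₀ inj T L τ) (hL : Fits n L) (hτ : τ < L) {k : Fin n} :
    stateAfter k (conf L₀ inj (T + τ) k).state (T + τ) (labels L₀ inj (T + τ) k)
      (heardAt L₀ inj (T + τ)).isSome = canon n T L (cnt L₀ inj T T) k (τ + 1) := by
  have hpos : position k.pos (canon n T L (cnt L₀ inj T T) k τ).len
      (T + τ - (canon n T L (cnt L₀ inj T T) k τ).start) = position k.pos L τ := by
    simp [canon]
  unfold stateAfter
  simp only [h.refresh_eq hτ, hpos]
  rcases lt_or_ge τ (gossipLen n L) with h1 | h1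
  · obtain ⟨i, j, b, hb, hp⟩ := exists_gossip h1
    have hpg : position k.pos L τ = .gossip i j b := by rw [hp, position_gossip k.pos i j hb]
    rw [hpg]
    by_cases hkj : k = j ∧ i ≠ j
    · simp only [if_pos hkj]
      obtain ⟨rfl, hij⟩ := hkj
      rw [h.heardAt_gossip hL hτ hb hp hij, hp]
      exact canon_succ_of_gossip hij hb
    · simp only [if_neg hkj]
      symm
      apply canon_succ
      rintro ⟨i', b', h2, h3, h4⟩
      obtain ⟨rfl, rfl, rfl⟩ := gossip_inj hb h3 (hp.symm.trans h4)
      exact hkj ⟨rfl, h2⟩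
  · have h2 : canon n T L (cnt L₀ inj T T) k (τ + 1) = canon n T L (cnt L₀ inj T T) k τ := by
      apply canon_succ
      rintro ⟨i, b, _, hb, hp⟩
      have := gossip_lt i k hb
      omega
    rw [h2]
    have h3 : ∀ i j b, position k.pos L τ ≠ .gossip i j b := by
      intro i j b
      rw [position, if_neg (by omega)]
      split_ifs <;> simp
    split
    · next h4 => exact absurd h4 (h3 _ _ _)
    · rfl

theorem succ (h : Inv L₀ inj T L τ) (hL : Fits n L) (hτ : τ < L) : Inv L₀ inj T L (τ + 1) := by
  have hoff : ∀ k, ¬ Awake L₀ inj (T + τ) k →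
      canon n T L (cnt L₀ inj T T) k (τ + 1) = canon n T L (cnt L₀ inj T T) k τ := by
    intro k hk
    apply canon_succ
    rintro ⟨i, b, _, hb, hp⟩
    exact hk ((h.awake_gossip hτ hb hp k).2 (Or.inr rfl))
  have hon : ∀ k, Awake L₀ inj (T + τ) k →
      (conf L₀ inj (T + τ + 1) k).state = canon n T L (cnt L₀ inj T T) k (τ + 1) := by
    intro k hk
    rw [state_succ_of_awake hk, h.stateAfter_eq hL hτ]
  refine ⟨?_, ?_, ?_⟩
  · intro hτ' k
    rw [← add_assoc]
    by_cases hk : Awake L₀ inj (T + τ) k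
    · rw [hon k hk, refresh, if_neg]
      simp only [canon]
      omega
    · have h1 := h.refresh_eq hτ k
      rw [hoff k hk, ← h1, state_succ_of_not_awake hk]
      exact refresh_succ (Nat.le_add_right T τ) (L := L) (by omega) (by rw [h1]; rfl)
        (by rw [h1]; rfl) (queue_succ_of_not_awake hk)
  · intro k hk
    rw [← add_assoc]
    by_cases hk' : Awake L₀ inj (T + τ) k
    · exact hon k hk'
    · have hne : k.1 * phaseLen L ≠ τ := by
        intro he
        have hp : τ = ((⟨0, k.pos⟩ : Fin n).1 * n + k.1) * phaseLen L + 0 := by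
          simp [← he]
        exact hk' ((h.awake_gossip hτ (phaseLen_pos L) hp k).2 (Or.inr rfl))
      rw [state_succ_of_not_awake hk', hoff k hk']
      exact h.state_eq k (by omega)
  · intro hG k
    have h0 := h.enough (by omega) k
    obtain ⟨i, j, b, hb, hp⟩ := exists_gossip (show τ < gossipLen n L by omega)
    have h1 := h.gossip_round hL hτ hb hp
    rw [← add_assoc]
    split_ifs at h1 with hbit
    · obtain ⟨m, x, h1, hx⟩ := h1
      have h2 := h1.sum_cnt_le (Nat.le_add_right T τ) hx k
      split_ifs at h2 with hk
      · subst hk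
        have h4 : τ = k.1 * (n * phaseLen L) + (j.1 * phaseLen L + b) := by rw [hp]; ring
        omega
      · omega
    · simp only [h1.cnt_succ (Nat.le_add_right T τ)]
      omega

/-- At the end of a window, all stations compute the same size of the next one. -/
theorem zero_of_end (h : Inv L₀ inj T L L) (hL : Fits n L) :
    Inv L₀ inj (T + L) (nextSize L (cnt L₀ inj T T)) 0 := by
  refine ⟨?_, fun k hk => absurd hk (Nat.not_lt_zero _), fun _ i => Nat.le_add_right _ _⟩
  intro _ k
  have hG : gossipLen n L ≤ L := by have := hL.stages k.pos; omega
  have h1 := h.state_main hG k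
  have h2 : nextLen k (canon n T L (cnt L₀ inj T T) k L) = nextSize L (cnt L₀ inj T T) :=
    Conveys.nextLen_eq (s := canon n T L (cnt L₀ inj T T) k L) (report_canon hG)
  have h3 : (canon n T L (cnt L₀ inj T T) k L).start + (canon n T L (cnt L₀ inj T T) k L).len ≤
    T + L := le_rfl
  rw [add_zero, h1, refresh, if_pos h3, roll, if_pos h3, h2]
  simp only [canon, countP_labels, Nat.not_lt_zero, false_and, and_false, decide_false,
    Bool.false_and]

theorem zero_zero (hL : 0 < L₀) : Inv L₀ inj 0 L₀ 0 := by
  refine ⟨?_, fun k hk => absurd hk (Nat.not_lt_zero _), fun _ i => Nat.le_add_right _ _⟩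
  intro _ k
  rw [add_zero, conf_zero, refresh, if_neg (by simp; omega)]
  have h1 : cnt L₀ inj 0 0 k = fun _ => 0 := by funext d; simp [cnt, conf_zero]
  simp only [canon, Nat.not_lt_zero, false_and, and_false, decide_false, Bool.false_and, h1]

end Inv

/-! ### The sequence of windows -/

/-- A window of size `L` begins in round `T`. -/
inductive IsWindow (L₀ : ℕ) (inj : Injections n) : ℕ → ℕ → Prop
  | zero : IsWindow L₀ inj 0 L₀
  | succ {T L : ℕ} : IsWindow L₀ inj T L →
      IsWindow L₀ inj (T + L) (nextSize L (cnt L₀ inj T T))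

theorem IsWindow.fits {L : ℕ} (h : IsWindow L₀ inj T L) (hL₀ : Fits n L₀) : Fits n L := by
  induction h with
  | zero => exact hL₀
  | succ _ ih => exact ih.nextSize _

theorem Inv.of_zero {L τ : ℕ} (h : Inv L₀ inj T L 0) (hL : Fits n L) (hτ : τ ≤ L) :
    Inv L₀ inj T L τ := by
  induction τ with
  | zero => exact h
  | succ τ ih => exact (ih (by omega)).succ hL (by omega)

theorem IsWindow.inv {L τ : ℕ} (h : IsWindow L₀ inj T L) (hL₀ : Fits n L₀) (hτ : τ ≤ L) :
    Inv L₀ inj T L τ := by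
  refine Inv.of_zero ?_ (h.fits hL₀) hτ
  clear hτ
  induction h with
  | zero => exact Inv.zero_zero hL₀.1
  | succ h ih => exact (ih.of_zero (h.fits hL₀) le_rfl).zero_of_end (h.fits hL₀)

theorem exists_window (hL₀ : Fits n L₀) (t : ℕ) :
    ∃ T L τ, IsWindow L₀ inj T L ∧ τ < L ∧ t = T + τ := by
  induction t with
  | zero => exact ⟨0, L₀, 0, .zero, hL₀.1, rfl⟩
  | succ t ih =>
    obtain ⟨T, L, τ, hw, hτ, rfl⟩ := ih
    rcases Nat.lt_or_ge (τ + 1) L with h | h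
    · exact ⟨T, L, τ + 1, hw, h, rfl⟩
    · exact ⟨T + L, _, 0, hw.succ, (hw.succ.fits hL₀).1, by omega⟩

theorem regular (hL₀ : Fits n L₀) (hn : 0 < n) (t : ℕ) : Regular L₀ inj t := by
  obtain ⟨T, L, τ, hw, hτ, rfl⟩ := exists_window (inj := inj) hL₀ t
  rcases (hw.inv hL₀ hτ.le).regular (hw.fits hL₀) hτ hn with h | ⟨a, b, m, x, h, _⟩
  · exact Or.inl h
  · exact Or.inr ⟨a, b, m, x, h⟩

end MAC.AdjustWindow

namespace MAC.AdjustWindow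

variable {n L₀ : ℕ} {inj : Injections n} {T L t : ℕ}

/-! ### Windows that clear the queues -/

open Classical in
/-- The rounds among the first `τ` of a window in which station `i` is addressed in a Gossip
phase. -/
noncomputable def addressed (L τ : ℕ) (i : Fin n) : Finset ℕ :=
  {s ∈ Finset.range τ | ∃ (r : Fin n) (b : ℕ), b < phaseLen L ∧
    s = (r.1 * n + i.1) * phaseLen L + b}

theorem card_addressed_le (L τ : ℕ) (i : Fin n) : (addressed L τ i).card ≤ n * phaseLen L := by
  have h1 : addressed L τ i ⊆ (Finset.univ ×ˢ Finset.range (phaseLen L)).image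
      fun x : Fin n × ℕ => (x.1.1 * n + i.1) * phaseLen L + x.2 := by
    intro s hs
    unfold addressed at hs
    obtain ⟨_, r, b, hb, hs⟩ := Finset.mem_filter.1 hs
    exact Finset.mem_image.2 ⟨(r, b), by simpa using hb, hs.symm⟩
  refine (Finset.card_le_card h1).trans (Finset.card_image_le.trans ?_)
  simp

/-- In the Gossip stage, a station adopts at most one packet per round in which it is addressed. -/
theorem Inv.cnt_gossip_le (h : Inv L₀ inj T L 0) (hL : Fits n L) {τ : ℕ}
    (hτ : τ ≤ gossipLen n L) (k d : Fin n) :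
    cnt L₀ inj T (T + τ) k d ≤ cnt L₀ inj T T k d + (addressed L τ k).card := by
  have hstages := hL.stages k.pos
  induction τ with
  | zero => exact Nat.le_add_right _ _
  | succ τ ih =>
    have ih := ih (by omega)
    have hi := h.of_zero hL (show τ ≤ L by omega)
    obtain ⟨i, j, b, hb, hp⟩ := exists_gossip (show τ < gossipLen n L by omega)
    have h1 := hi.gossip_round hL (by omega) hb hp
    have hmono : addressed L τ k ⊆ addressed L (τ + 1) k := by
      unfold addressed
      exact Finset.filter_subset_filter _ (Finset.range_subset_range.2 (Nat.le_succ τ))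
    rw [← add_assoc]
    split_ifs at h1 with hbit
    · obtain ⟨m, x, h1, hx⟩ := h1
      have h2 := h1.cnt_succ (Nat.le_add_right T τ) hx k d
      by_cases hk : k = j
      · subst hk
        have h3 : (addressed L τ k).card < (addressed L (τ + 1) k).card := by
          apply Finset.card_lt_card
          refine Finset.ssubset_iff_subset_ne.2 ⟨hmono, fun he => ?_⟩
          have : τ ∈ addressed L (τ + 1) k := by
            unfold addressed
            exact Finset.mem_filter.2 ⟨Finset.self_mem_range_succ τ, i, b, hb, hp⟩
          rw [← he] at this
          unfold addressed at this
          simp at this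
        split_ifs at h2 <;> omega
      · rw [if_neg (c := k ≠ i ∧ _) (by tauto)] at h2
        have := Finset.card_le_card hmono
        omega
    · rw [h1.cnt_succ (Nat.le_add_right T τ)]
      have := Finset.card_le_card hmono
      omega

/-- After the Gossip stage, no packet is adopted. -/
theorem Inv.cnt_antitone (h : Inv L₀ inj T L 0) (hL : Fits n L) {σ τ : ℕ}
    (hσ : gossipLen n L ≤ σ) (hστ : σ ≤ τ) (hτ : τ ≤ L) (k d : Fin n) :
    cnt L₀ inj T (T + τ) k d ≤ cnt L₀ inj T (T + σ) k d := by
  induction τ, hστ using Nat.le_induction with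
  | base => exact le_rfl
  | succ τ hστ ih =>
    refine le_trans ?_ (ih (by omega))
    rw [← add_assoc]
    rcases (h.of_zero hL (show τ ≤ L by omega)).round_cases hL (by omega) k.pos with
      ⟨i, j, b, hb, hp⟩ | ⟨_, ⟨i, e, h1⟩ | h1⟩
    · have := gossip_lt i j hb
      omega
    · exact h1.cnt_le (Nat.le_add_right T τ) k d
    · exact (h1.1.cnt_succ (Nat.le_add_right T τ) k d).le

/-- In a clean window, the Main stage serves the packets that the large stations had at the
beginning; what is left are few packets of small stations and few adopted packets. -/
theorem Inv.cnt_main_le (h : Inv L₀ inj T L 0) (hL : Fits n L)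
    (hc : Clean L (cnt L₀ inj T T)) (i d : Fin n) :
    cnt L₀ inj T (T + (gossipLen n L + mainLen n L)) i d ≤ 8 * n * lg L := by
  have hstages := hL.stages i.pos
  have hP := hL.mul_phaseLen_le i.pos
  have hG : cnt L₀ inj T (T + gossipLen n L) i d ≤ cnt L₀ inj T T i d + 4 * n * lg L :=
    (h.cnt_gossip_le hL le_rfl i d).trans
      (by have := card_addressed_le L (gossipLen n L) i; omega)
  by_cases hi : (own L (cnt L₀ inj T T) i).large = true
  · have hle := hc.le_mainLen hi d
    set B := blockStart (own L (cnt L₀ inj T T)) i + ∑ e with e < d, cnt L₀ inj T T i e with hB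
    have hstep : ∀ s ≤ cnt L₀ inj T T i d, cnt L₀ inj T (T + (gossipLen n L + (B + s))) i d ≤
        cnt L₀ inj T T i d + 4 * n * lg L - s := by
      intro s
      induction s with
      | zero =>
        intro _
        exact (h.cnt_antitone hL le_rfl (Nat.le_add_right _ _) (by omega) i d).trans hG
      | succ s ih =>
        intro hs
        have ih := ih (by omega)
        have h1 := ((h.of_zero hL (show gossipLen n L + (B + s) ≤ L by omega)).main_round_slot hL
          (by omega) (hc.slot hi (show s < _ by omega))).cnt_le_sub_one (Nat.le_add_right T _)
        have h2 : T + (gossipLen n L + (B + (s + 1))) = T + (gossipLen n L + (B + s)) + 1 := by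
          omega
        rw [h2]
        omega
    have h1 := hstep _ le_rfl
    have h2 := h.cnt_antitone hL (Nat.le_add_right (gossipLen n L) _)
      (show gossipLen n L + (B + cnt L₀ inj T T i d) ≤ gossipLen n L + mainLen n L by omega)
      (by omega) i d
    have h3 : 4 * n * lg L ≤ 8 * n * lg L := by gcongr; norm_num
    omega
  · have h1 : ∑ e, cnt L₀ inj T T i e < 4 * n * lg L := by
      simpa [own, reportOf] using hi
    have h2 := Finset.single_le_sum (f := fun e => cnt L₀ inj T T i e) (fun _ _ => Nat.zero_le _)
      (Finset.mem_univ d)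
    have h3 := h.cnt_antitone hL le_rfl (Nat.le_add_right (gossipLen n L) (mainLen n L))
      (by omega) i d
    have h4 : 4 * n * lg L + 4 * n * lg L = 8 * n * lg L := by ring
    omega

/-- Each sweep of the Auxiliary stage reduces each nonempty class of packets, so that no old packet
is left at the end of a clean window. -/
theorem Inv.cnt_end_eq_zero (h : Inv L₀ inj T L 0) (hL : Fits n L)
    (hc : Clean L (cnt L₀ inj T T)) (i d : Fin n) : cnt L₀ inj T (T + L) i d = 0 := by
  have hstages := hL.stages i.pos
  have hA : auxLen n L = 8 * n * lg L * n ^ 2 := by unfold auxLen; ring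
  set M := gossipLen n L + mainLen n L with hM
  have hsweep : ∀ r ≤ 8 * n * lg L, cnt L₀ inj T (T + (M + r * n ^ 2)) i d ≤ 8 * n * lg L - r := by
    intro r
    induction r with
    | zero =>
      intro _
      simpa using h.cnt_main_le hL hc i d
    | succ r ih =>
      intro hr
      have ih := ih (by omega)
      have h0 := pair_lt i d
      have h1 : (r + 1) * n ^ 2 = r * n ^ 2 + n ^ 2 := by ring
      have h2 : (r + 1) * n ^ 2 ≤ auxLen n L := by rw [hA]; gcongr
      have h3 := ((h.of_zero hL (show M + (r * n ^ 2 + (i.1 * n + d.1)) ≤ L by omega)).aux_round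
        (by omega)).cnt_le_sub_one (Nat.le_add_right T _)
      have h4 := h.cnt_antitone hL (show gossipLen n L ≤ M + r * n ^ 2 by omega)
        (show M + r * n ^ 2 ≤ M + (r * n ^ 2 + (i.1 * n + d.1)) by omega) (by omega) i d
      have h5 := h.cnt_antitone hL
        (show gossipLen n L ≤ M + (r * n ^ 2 + (i.1 * n + d.1)) + 1 by omega)
        (show M + (r * n ^ 2 + (i.1 * n + d.1)) + 1 ≤ M + (r + 1) * n ^ 2 by omega) (by omega) i d
      rw [← add_assoc T _ 1] at h5
      rw [← hM] at h3
      omega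
  have h1 := hsweep _ le_rfl
  have h2 : M + 8 * n * lg L * n ^ 2 = L := by omega
  rw [h2] at h1
  omega

/-! ### The age of packets -/

theorem mem_queue_succ (hr : Regular L₀ inj t) {k : Fin n} {x : Stored n}
    (hx : x ∈ (conf L₀ inj (t + 1) k).queue) :
    x ∈ (conf L₀ inj t k).queue ∨ x.relayed = true ∨ x ∈ fresh inj t k := by
  rcases hr with h | ⟨a, b, m, y, h⟩
  · rw [h.queue, List.mem_append] at hx
    tauto
  · rw [h.queue, List.mem_append] at hx
    rcases hx with hx | hx
    · split_ifs at hx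
      · exact Or.inl (List.mem_of_mem_eraseIdx hx)
      · rw [List.mem_append, List.mem_singleton] at hx
        rcases hx with hx | rfl
        · exact Or.inl hx
        · exact Or.inr (Or.inl rfl)
      · exact Or.inl hx
    · exact Or.inr (Or.inr hx)

theorem round_eq_since (hr : ∀ t, Regular L₀ inj t) (t : ℕ) {k : Fin n} {x : Stored n}
    (hx : x ∈ (conf L₀ inj t k).queue) (hrel : x.relayed = false) : x.packet.round = x.since := by
  induction t with
  | zero => rw [conf_zero] at hx; cases hx
  | succ t ih =>
    rcases mem_queue_succ (hr t) hx with h | h | h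
    · exact ih h
    · rw [h] at hrel; cases hrel
    · unfold fresh at h
      obtain ⟨p, hp, rfl⟩ := List.mem_map.1 h
      exact (mem_injected hp).1

theorem le_round_of_cnt_eq_zero (hr : ∀ t, Regular L₀ inj t)
    (h : ∀ k d, cnt L₀ inj T t k d = 0) {p : Packet n} (hp : p ∈ pool L₀ inj t) : T ≤ p.round := by
  obtain ⟨k, x, hx, rfl⟩ := mem_pool.1 hp
  have h1 := h k x.packet.dest
  rw [cnt, List.countP_eq_zero] at h1
  have h2 := h1 x hx
  simp only [isOld, Stored.label, decide_true, Bool.and_true, Bool.or_eq_true, not_or,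
    Bool.not_eq_true] at h2
  rw [round_eq_since hr t hx h2.1]
  exact not_lt.1 (of_decide_eq_false h2.2)

theorem sum_countP_le {α : Type*} (p : α → Bool) (f : α → Fin n) (l : List α) :
    ∑ d, l.countP (fun x => p x && decide (f x = d)) ≤ l.length := by
  induction l with
  | nil => simp
  | cons a l ih =>
    simp only [List.countP_cons, Finset.sum_add_distrib, List.length_cons]
    gcongr
    calc _ ≤ ∑ d, (if f a = d then 1 else 0) := by
          apply Finset.sum_le_sum
          intro d _
          by_cases hd : f a = d
          · simp only [hd, if_true]; split_ifs <;> omega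
          · simp [hd]
      _ = 1 := by simp

theorem sum_cnt_le_card_pool (T t : ℕ) :
    ∑ k, ∑ d, cnt L₀ inj T t k d ≤ (pool L₀ inj t).card := by
  unfold pool
  rw [Multiset.card_sum]
  apply Finset.sum_le_sum
  intro k _
  rw [Multiset.coe_card, List.length_map]
  exact sum_countP_le (fun x : Stored n => isOld T x.label) (fun x => x.packet.dest) _

/-- The packets in the queues at the beginning of a window are not older than the window is long:
the size is doubled whenever packets may be left over. -/
theorem IsWindow.le_round_add (hw : IsWindow L₀ inj T L) (hL₀ : Fits n L₀) (hn : 0 < n) :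
    ∀ p ∈ pool L₀ inj T, T ≤ p.round + L := by
  have hr := regular (inj := inj) hL₀ hn
  induction hw with
  | zero => intro p hp; omega
  | @succ T L hw ih =>
    intro p hp
    unfold nextSize
    split_ifs with hc
    · have := le_round_of_cnt_eq_zero hr
        ((hw.inv hL₀ (Nat.zero_le _)).cnt_end_eq_zero (hw.fits hL₀) hc) hp
      omega
    · by_cases hpT : p.round < T
      · have := ih p (mem_pool_mono hr hpT (Nat.le_add_right T L) hp)
        omega
      · omega

theorem IsWindow.card_pool_le (hw : IsWindow L₀ inj T L) (hL₀ : Fits n L₀) (hn : 0 < n)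
    {ρ β : ℝ} (hρ : 0 < ρ) (hinj : IsOfType inj ρ β) :
    ((pool L₀ inj T).card : ℝ) ≤ ρ * L + β := by
  have h1 := pool_le_sum_arrivals (regular (inj := inj) hL₀ hn) (s := T - L) (t := T) fun p hp => by
    have := hw.le_round_add hL₀ hn p hp
    omega
  have h2 := Multiset.card_le_card h1
  rw [Multiset.card_sum] at h2
  simp only [card_arrivals] at h2
  have h3 := hinj (T - L) (T - (T - L))
  rw [show T - L + (T - (T - L)) = T by omega] at h3
  have h4 : ((T - (T - L) : ℕ) : ℝ) ≤ L := by
    exact_mod_cast (by omega : T - (T - L) ≤ L)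
  calc ((pool L₀ inj T).card : ℝ) ≤ _ := Nat.cast_le.2 h2
    _ ≤ ρ * (T - (T - L) : ℕ) + β := h3
    _ ≤ ρ * L + β := by gcongr

/-! ### Latency -/

theorem IsWindow.clean (hw : IsWindow L₀ inj T L) (hL₀ : Fits n L₀) (hn : 0 < n)
    {ρ β : ℝ} (hρ : 0 < ρ) (hinj : IsOfType inj ρ β) (h : ρ * L + β ≤ mainLen n L) :
    Clean L (cnt L₀ inj T T) := by
  by_contra hc
  have h1 := (mainLen_lt_of_not_clean hc).trans_le (sum_cnt_le_card_pool T T)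
  have h2 := hw.card_pool_le hL₀ hn hρ hinj
  have h3 : ((mainLen n L : ℕ) : ℝ) < (pool L₀ inj T).card := Nat.cast_lt.2 h1
  linarith

/-- The window size is never doubled beyond a size for which the Main stage is long enough. -/
theorem IsWindow.exists_size (hw : IsWindow L₀ inj T L) (hL₀ : Fits n L₀) (hn : 0 < n)
    {ρ β : ℝ} (hρ : 0 < ρ) (hinj : IsOfType inj ρ β) {i : ℕ}
    (h : ρ * (2 ^ i * L₀ : ℕ) + β ≤ mainLen n (2 ^ i * L₀)) : ∃ j ≤ i, L = 2 ^ j * L₀ := by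
  induction hw with
  | zero => exact ⟨0, Nat.zero_le i, by simp⟩
  | @succ T L hw ih =>
    obtain ⟨j, hj, hL⟩ := ih
    unfold nextSize
    split_ifs with hc
    · exact ⟨j, hj, hL⟩
    · refine ⟨j + 1, ?_, by rw [hL]; ring⟩
      by_contra hji
      obtain rfl : j = i := by omega
      rw [← hL] at h
      exact hc (hw.clean hL₀ hn hρ hinj h)

theorem IsWindow.exists_clean (hw : IsWindow L₀ inj T L) (hL₀ : Fits n L₀) (hn : 0 < n)
    {ρ β : ℝ} (hρ : 0 < ρ) (hinj : IsOfType inj ρ β) {i : ℕ}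
    (h : ρ * (2 ^ i * L₀ : ℕ) + β ≤ mainLen n (2 ^ i * L₀)) :
    ∃ T' L', T ≤ T' ∧ IsWindow L₀ inj T' L' ∧ Clean L' (cnt L₀ inj T' T') := by
  obtain ⟨j, hj, hL⟩ := hw.exists_size hL₀ hn hρ hinj h
  obtain ⟨e, he⟩ := Nat.exists_eq_add_of_le hj
  -- The sizes double from one unclean window to the next, so this ends after `i - j` steps.
  induction e generalizing T L j with
  | zero =>
    refine ⟨T, L, le_rfl, hw, hw.clean hL₀ hn hρ hinj ?_⟩
    obtain rfl : j = i := by omega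
    rwa [hL]
  | succ e ih =>
    by_cases hc : Clean L (cnt L₀ inj T T)
    · exact ⟨T, L, le_rfl, hw, hc⟩
    · obtain ⟨T', L', h1, h2⟩ := ih hw.succ (j := j + 1) (by omega)
        (by rw [nextSize, if_neg hc, hL]; ring) (by omega)
      exact ⟨T', L', by omega, h2⟩

/-- A packet delivered in a window of size `L` was injected at most `L` rounds before that window
began. -/
theorem latencyAtMost (hL₀ : Fits n L₀) (hn : 0 < n) {ρ β : ℝ} (hρ : 0 < ρ)
    (hinj : IsOfType inj ρ β) {i : ℕ}
    (h : ρ * (2 ^ i * L₀ : ℕ) + β ≤ mainLen n (2 ^ i * L₀)) :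
    (algorithm n L₀).LatencyAtMost inj (2 * (2 ^ i * L₀ : ℕ)) := by
  have hr := regular (inj := inj) hL₀ hn
  intro r k p hp
  have hpr := (mem_injected hp).1
  have harr : p ∈ arrivals inj r := mem_arrivals.2 ⟨k, hp⟩
  obtain ⟨T, L, τ, hw, hτ, hrt⟩ := exists_window (inj := inj) hL₀ r
  obtain ⟨T', L', hT, hw', hc⟩ := hw.succ.exists_clean hL₀ hn hρ hinj h
  have hnot : p ∉ pool L₀ inj (T' + L') := by
    intro hp'
    have := le_round_of_cnt_eq_zero hr
      ((hw'.inv hL₀ (Nat.zero_le _)).cnt_end_eq_zero (hw'.fits hL₀) hc) hp'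
    omega
  obtain ⟨t, ht⟩ := exists_deliveredAt hr harr (by omega) hnot
  have htp := mem_pool_of_deliveredAt (hr t) ht
  have hrt' := (mem_arrivals_of_mem_pool hr htp).1
  refine ⟨t, fun t' => ⟨fun h' => deliveredAt_unique hr h' ht, fun h' => h' ▸ ht⟩, by omega, ?_⟩
  obtain ⟨T₁, L₁, τ₁, hw₁, hτ₁, rfl⟩ := exists_window (inj := inj) hL₀ t
  have h1 : T₁ ≤ r + L₁ := by
    by_cases hrT : r < T₁
    · have := hw₁.le_round_add hL₀ hn p
        (mem_pool_mono hr (by omega) (Nat.le_add_right T₁ τ₁) htp)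
      omega
    · omega
  obtain ⟨j, hj, hL⟩ := hw₁.exists_size hL₀ hn hρ hinj h
  have h2 : L₁ ≤ 2 ^ i * L₀ := by rw [hL]; gcongr; norm_num
  have h3 : T₁ + τ₁ ≤ r + 2 * (2 ^ i * L₀) := by omega
  have h4 : ((T₁ + τ₁ : ℕ) : ℝ) ≤ (r + 2 * (2 ^ i * L₀) : ℕ) := Nat.cast_le.2 h3
  push_cast at h4 ⊢
  linarith

end MAC.AdjustWindow

namespace MAC.AdjustWindow

variable {n L₀ : ℕ} {inj : Injections n}

/-! ### Plain packets and energy cap -/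

theorem lt_length_of_outPos {t m : ℕ} {k : Fin n} (h : outPos L₀ inj t k = some m) :
    m < (conf L₀ inj t k).queue.length := by
  have hfind : ∀ p : Label n → Bool, (labels L₀ inj t k).findIdx? p = some m →
      m < (conf L₀ inj t k).queue.length := by
    intro p hp
    obtain ⟨x, hx, _⟩ := exists_of_findIdx?_eq_some hp
    exact (List.getElem?_eq_some_iff.1 hx).1
  have hto : ∀ T d, firstTo T d (labels L₀ inj t k) = some m →
      m < (conf L₀ inj t k).queue.length := fun T d => hfind _
  unfold outPos sendPos at h
  simp only at h
  split at h
  · split_ifs at h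
    unfold firstPreferred at h
    rw [Option.or_eq_some_iff] at h
    rcases h with h | ⟨_, h⟩
    · exact hto _ _ h
    · exact hfind _ h
  · obtain ⟨d, _, h⟩ := Option.bind_eq_some_iff.1 h
    exact hto _ _ h
  · split_ifs at h
    exact hto _ _ h

theorem isPlainPacket (n L₀ : ℕ) : (algorithm n L₀).IsPlainPacket := by
  intro inj t i m hm
  change (algorithm n L₀).message t i (conf L₀ inj t i) = some m at hm
  rw [message_eq] at hm
  split_ifs at hm
  obtain ⟨p, hp, rfl⟩ := Option.map_eq_some_iff.1 hm
  simp [lt_length_of_outPos hp]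

theorem worksWithEnergyCap_two (hL₀ : Fits n L₀) : (algorithm n L₀).WorksWithEnergyCap 2 := by
  intro inj t
  rcases Nat.eq_zero_or_pos n with rfl | hn
  · simp [Set.eq_empty_of_isEmpty]
  · obtain ⟨T, L, τ, hw, hτ, rfl⟩ := exists_window (inj := inj) hL₀ t
    obtain ⟨a, b, hab⟩ := (hw.inv hL₀ hτ.le).awake_le_two (hw.fits hL₀) hτ hn
    have hsub : {i | (algorithm n L₀).IsOn inj (T + τ) i} ⊆ {a, b} := fun k hk => hab k hk
    exact (Set.ncard_le_ncard hsub).trans ((Set.ncard_insert_le a {b}).trans (by simp))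

/-! ### Relays -/

theorem dest_mem_of_mem_injected {t : ℕ} {k : Fin n} {p : Packet n} (h : p ∈ injected inj t k) :
    p.dest ∈ inj t k := by
  unfold injected at h
  rw [List.mem_mapIdx] at h
  obtain ⟨i, hi, rfl⟩ := h
  exact List.getElem_mem hi

/-- If station `0` starts with many packets to station `2` only, then it sends one of them to
station `1` in its Gossip phase. -/
theorem not_routesDirectly (hL₀ : Fits n L₀) (hn : 3 ≤ n) :
    ¬ (algorithm n L₀).RoutesDirectly := by
  intro hdir
  set s₀ : Fin n := ⟨0, by omega⟩ with hs₀
  set s₁ : Fin n := ⟨1, by omega⟩ with hs₁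
  set s₂ : Fin n := ⟨2, by omega⟩ with hs₂
  -- Large in a window of size at most `2 * L₀`.
  set K := 4 * n * (lg L₀ + 1) with hK
  set inj : Injections n := fun t i => if t = 0 ∧ i = s₀ then List.replicate K s₂ else [] with hinj
  have hlen : ∀ t, ∑ i, (inj t i).length = if t = 0 then K else 0 := by
    intro t
    by_cases ht : t = 0
    · simp [hinj, ht, apply_ite List.length]
    · simp [hinj, ht]
  have htype : IsOfType inj 1 (K + 1) := by
    intro s l
    have h1 : ∑ t ∈ Finset.Ico s (s + l), ∑ i, (inj t i).length ≤ K := by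
      simp only [hlen, Finset.sum_ite_eq']
      split_ifs <;> omega
    have h2 : ((∑ t ∈ Finset.Ico s (s + l), ∑ i, (inj t i).length : ℕ) : ℝ) ≤ K :=
      Nat.cast_le.2 h1
    have h3 : (0 : ℝ) ≤ l := Nat.cast_nonneg l
    linarith
  have hrel : ∀ t i, ∀ x ∈ (conf L₀ inj t i).queue, x.relayed = false :=
    hdir 1 (K + 1) inj one_pos le_rfl (by have : (0 : ℝ) ≤ K := Nat.cast_nonneg K; linarith) htype
  have hn0 : 0 < n := by omega
  have hr := regular (inj := inj) hL₀ hn0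
  -- No packet is old in the first window.
  have hsil : ∀ t < L₀, Silent L₀ inj t := by
    intro t ht
    have h1 := (IsWindow.zero (inj := inj)).inv hL₀ ht.le
    have h2 := h1.regular hL₀ ht hn0
    rw [zero_add] at h2
    rcases h2 with h2 | ⟨a, b, m, x, h2, h3⟩
    · exact h2
    · have := hrel t a x (List.mem_of_getElem? h2.get)
      simp [isOld, Stored.label, this] at h3
  have hq : ∀ t < L₀, (conf L₀ inj (t + 1) s₀).queue = fresh inj 0 s₀ := by
    intro t
    induction t with
    | zero => intro ht; rw [(hsil 0 ht).queue, conf_zero]; rfl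
    | succ t ih =>
      intro ht
      have : fresh inj (t + 1) s₀ = [] := by simp [fresh, injected, hinj]
      rw [(hsil _ ht).queue, ih (by omega), this, List.append_nil]
  have hcount : cnt L₀ inj L₀ L₀ s₀ s₂ = K := by
    have h0 := hL₀.1
    have h1 := hq (L₀ - 1) (by omega)
    rw [Nat.sub_add_cancel h0] at h1
    have h2 : (fresh inj 0 s₀).length = K := by simp [fresh, injected, hinj]
    rw [cnt, h1, ← h2, List.countP_eq_length]
    intro x hx
    unfold fresh at hx
    obtain ⟨p, hp, rfl⟩ := List.mem_map.1 hx
    have h3 := dest_mem_of_mem_injected hp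
    simp only [hinj, and_self, if_true] at h3
    simp [isOld, Stored.label, h0, List.eq_of_mem_replicate h3]
  have hw := (IsWindow.zero (L₀ := L₀) (inj := inj)).succ
  rw [zero_add] at hw
  set L := nextSize L₀ (cnt L₀ inj 0 0)
  have hL := hw.fits hL₀
  have hlgL : lg L ≤ lg L₀ + 1 := by
    refine le_trans (lg_mono ?_) (lg_two_mul_le L₀)
    change nextSize _ _ ≤ _
    unfold nextSize
    split_ifs <;> omega
  have hlarge : 4 * n * lg L ≤ ∑ d, cnt L₀ inj L₀ L₀ s₀ d := by
    calc _ ≤ K := by rw [hK]; gcongr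
      _ = cnt L₀ inj L₀ L₀ s₀ s₂ := hcount.symm
      _ ≤ _ := Finset.single_le_sum (f := fun d => cnt L₀ inj L₀ L₀ s₀ d)
        (fun _ _ => Nat.zero_le _) (Finset.mem_univ s₂)
  have h1 := gossip_lt (L := L) s₀ s₁ (phaseLen_pos L)
  have h2 : (s₀.1 * n + s₁.1) * phaseLen L + 0 < L := by have := hL.stages hn0; omega
  have h3 := (hw.inv hL₀ h2.le).gossip_round hL h2 (phaseLen_pos L) rfl
  rw [if_pos ⟨by simp [hs₀, hs₁], by simpa [Report.bit, reportOf] using hlarge⟩] at h3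
  obtain ⟨m, x, h3, _⟩ := h3
  set t := L₀ + ((s₀.1 * n + s₁.1) * phaseLen L + 0)
  have hdest : x.packet.dest = s₂ := by
    have h4 := mem_arrivals_of_mem_pool hr
      (mem_pool.2 ⟨s₀, x, List.mem_of_getElem? h3.get, rfl⟩)
    obtain ⟨k, hk⟩ := mem_arrivals.1 h4.2
    have h5 := dest_mem_of_mem_injected hk
    simp only [hinj] at h5
    split_ifs at h5
    · exact List.eq_of_mem_replicate h5
    · cases h5
  have h5 := h3.queue s₁
  rw [if_neg (by simp [hs₀, hs₁]), if_pos ⟨rfl, by simp [hdest, hs₀, hs₂], by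
    simp [hdest, hs₁, hs₂]⟩] at h5
  have h6 := hrel (t + 1) s₁ ⟨x.packet, t, true⟩ (by rw [h5]; simp)
  cases h6

/-! ### Bounds on the window size -/

theorem lg_two_pow_mul_le (i L : ℕ) : lg (2 ^ i * L) ≤ lg L + i := by
  induction i with
  | zero => simp
  | succ i ih =>
    have := lg_two_mul_le (2 ^ i * L)
    rw [pow_succ, mul_comm (2 ^ i) 2, mul_assoc]
    omega

/-- The number of doublings depends on the adversary only, and not on `n`. -/
theorem exists_doublings {ρ : ℝ} (hρ : ρ < 1) (β : ℝ) :
    ∃ i : ℕ, β + 1 + i ≤ 2 ^ i * (1 - ρ) := by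
  have h1 := tendsto_pow_const_mul_const_pow_of_abs_lt_one 1
    (show |(1 / 2 : ℝ)| < 1 by rw [abs_of_pos] <;> norm_num)
  have h2 := (tendsto_pow_atTop_nhds_zero_of_abs_lt_one
    (show |(1 / 2 : ℝ)| < 1 by rw [abs_of_pos] <;> norm_num)).const_mul (β + 1)
  have h3 := h2.add h1
  rw [mul_zero, add_zero] at h3
  obtain ⟨i, hi⟩ := (h3.eventually (gt_mem_nhds (show (0 : ℝ) < 1 - ρ by linarith))).exists
  refine ⟨i, ?_⟩
  have h4 : (2 : ℝ) ^ i * (1 / 2) ^ i = 1 := by rw [← mul_pow]; norm_num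
  have h5 : (0 : ℝ) < 2 ^ i := by positivity
  have h6 := mul_le_mul_of_nonneg_left hi.le h5.le
  rw [pow_one] at h6
  calc β + 1 + i = (β + 1 + i) * (2 ^ i * (1 / 2) ^ i) := by rw [h4, mul_one]
    _ = 2 ^ i * ((β + 1) * (1 / 2) ^ i + i * (1 / 2) ^ i) := by ring
    _ ≤ _ := h6

theorem le_mainLen (hL₀ : Fits n L₀) (hn : 0 < n) {ρ β : ℝ} (hβ : 0 ≤ β) {i : ℕ}
    (hi : β + 1 + i ≤ 2 ^ i * (1 - ρ)) :
    ρ * (2 ^ i * L₀ : ℕ) + β ≤ mainLen n (2 ^ i * L₀) := by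
  have hfits : Fits n (2 ^ i * L₀) := by
    clear hi
    induction i with
    | zero => simpa using hL₀
    | succ i ih => rw [pow_succ, mul_comm (2 ^ i) 2, mul_assoc]; exact ih.two_mul
  have h1 := hfits.stages hn
  have h2 := hfits.gossip_add_aux_le hn
  have h3 : 12 * n ^ 3 * lg (2 ^ i * L₀) ≤ 12 * n ^ 3 * lg L₀ + 12 * n ^ 3 * i := by
    rw [← mul_add]
    gcongr
    exact lg_two_pow_mul_le i L₀
  have h4 : 12 * n ^ 3 * lg L₀ ≤ L₀ := by
    refine le_trans ?_ hL₀.2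
    gcongr
    norm_num
  have h5 : 12 * n ^ 3 * i ≤ L₀ * i := by
    gcongr
    calc 12 * n ^ 3 = 12 * n ^ 3 * 1 := by ring
      _ ≤ 12 * n ^ 3 * lg L₀ := by gcongr; exact lg_pos hL₀.1
      _ ≤ L₀ := h4
  have h6 : 2 ^ i * L₀ ≤ mainLen n (2 ^ i * L₀) + L₀ + L₀ * i := by omega
  have h7 : ((2 ^ i * L₀ : ℕ) : ℝ) ≤ (mainLen n (2 ^ i * L₀) + L₀ + L₀ * i : ℕ) := Nat.cast_le.2 h6
  have h8 : (1 : ℝ) ≤ L₀ := by exact_mod_cast hL₀.1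
  have h9 : β * 1 ≤ β * L₀ := by gcongr
  have h10 : (β + 1 + i) * L₀ ≤ 2 ^ i * (1 - ρ) * L₀ := by gcongr
  push_cast at h7 ⊢
  linarith

theorem isUniversal (hL₀ : Fits n L₀) : (algorithm n L₀).IsUniversal := by
  intro ρ β hρ hρ1 hβ
  rcases Nat.eq_zero_or_pos n with rfl | hn
  · exact ⟨0, fun inj _ r k => k.elim0⟩
  · obtain ⟨i, hi⟩ := exists_doublings hρ1 β
    exact ⟨_, fun inj hinj => latencyAtMost hL₀ hn hρ hinj (le_mainLen hL₀ hn (by linarith) hi)⟩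

/-- The first window has size `O(n ^ 3 * log n)`. -/
theorem initialLen_le_of_le (hn : 18 * (4 * Nat.clog 2 n + 1) ≤ n) :
    initialLen n ≤ n ^ 3 * (18 * (4 * Nat.clog 2 n + 1)) := by
  set m := 18 * (4 * Nat.clog 2 n + 1) with hm
  have hn0 : 0 < n := by omega
  apply initialLen_le
  refine ⟨by positivity, ?_⟩
  have h1 : lg (n ^ 3 * m) ≤ 4 * Nat.clog 2 n + 1 := by
    unfold lg
    rw [Nat.clog_le_iff_le_pow one_lt_two, pow_succ 2]
    have h2 : n ^ 3 * m ≤ 2 ^ (4 * Nat.clog 2 n) := by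
      calc n ^ 3 * m ≤ n ^ 3 * n := by gcongr
        _ = n ^ 4 := by ring
        _ ≤ (2 ^ Nat.clog 2 n) ^ 4 := by gcongr; exact Nat.le_pow_clog one_lt_two n
        _ = _ := by rw [← pow_mul, mul_comm]
    have := Nat.one_le_two_pow (n := 4 * Nat.clog 2 n)
    omega
  calc 18 * n ^ 3 * lg (n ^ 3 * m) ≤ 18 * n ^ 3 * (4 * Nat.clog 2 n + 1) := by gcongr
    _ = n ^ 3 * m := by rw [hm]; ring

theorem clog_le_logb (n : ℕ) : (Nat.clog 2 n : ℝ) ≤ Real.logb 2 n + 1 := by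
  have h1 : (Nat.clog 2 n : ℝ) ≤ (Nat.log 2 n + 1 : ℕ) := by
    rw [Nat.cast_le, Nat.clog_le_iff_le_pow one_lt_two]
    exact (Nat.lt_pow_succ_log_self one_lt_two n).le
  have h2 := Real.natLog_le_logb n 2
  push_cast at h1 h2
  linarith

/-- For large `n`, a constant number of doublings of the first window is negligible against
`n ^ 3 * log n ^ 2`. -/
theorem eventually_initialLen_le (C : ℝ) :
    ∀ᶠ n : ℕ in Filter.atTop, 0 < n ∧
      C * initialLen n ≤ 18 * (n : ℝ) ^ 3 * Real.logb 2 n ^ 2 := by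
  have hlog2 := Real.log_two_gt_d9
  have h1 : ∀ᶠ n : ℕ in Filter.atTop, ‖Real.log n‖ ≤ 1 / 300 * ‖(n : ℝ)‖ :=
    tendsto_natCast_atTop_atTop.eventually
      (Real.isLittleO_log_id_atTop.bound (show (0 : ℝ) < 1 / 300 by norm_num))
  have h2 : ∀ᶠ n : ℕ in Filter.atTop, max 1 (9 * max C 0) ≤ Real.logb 2 n :=
    ((Real.tendsto_logb_atTop one_lt_two).comp tendsto_natCast_atTop_atTop).eventually_ge_atTop _
  filter_upwards [h1, h2, Filter.eventually_ge_atTop 180] with n h1 h2 h3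
  have hn : 0 < n := by omega
  have h3' : (180 : ℝ) ≤ n := by exact_mod_cast h3
  set x := Real.logb 2 n with hx
  have hx1 : 1 ≤ x := le_trans (le_max_left _ _) h2
  have hx2 : 9 * max C 0 ≤ x := le_trans (le_max_right _ _) h2
  have hclog := clog_le_logb n
  have hxn : x ≤ n / 200 := by
    rw [Real.norm_of_nonneg (Real.log_nonneg (by linarith)), Real.norm_of_nonneg (by linarith)]
      at h1
    rw [hx, Real.logb, div_le_iff₀ (by linarith)]
    nlinarith
  have hm : 18 * (4 * Nat.clog 2 n + 1) ≤ n := by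
    have : ((18 * (4 * Nat.clog 2 n + 1) : ℕ) : ℝ) ≤ n := by push_cast; linarith
    exact_mod_cast this
  refine ⟨hn, ?_⟩
  have h4 : (initialLen n : ℝ) ≤ (n ^ 3 * (18 * (4 * Nat.clog 2 n + 1)) : ℕ) :=
    Nat.cast_le.2 (initialLen_le_of_le hm)
  push_cast at h4
  have hC : 0 ≤ max C 0 := le_max_right _ _
  calc C * initialLen n ≤ max C 0 * initialLen n := by gcongr; exact le_max_left _ _
    _ ≤ max C 0 * ((n : ℝ) ^ 3 * (18 * (4 * Nat.clog 2 n + 1))) := by gcongr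
    _ ≤ max C 0 * ((n : ℝ) ^ 3 * (18 * (9 * x))) := by gcongr; linarith
    _ = 18 * (n : ℝ) ^ 3 * (9 * max C 0 * x) := by ring
    _ ≤ 18 * (n : ℝ) ^ 3 * (x * x) := by gcongr
    _ = _ := by ring

theorem exists_latencyAtMost {ρ β : ℝ} (hρ : 0 < ρ) (hρ1 : ρ < 1) (hβ : 1 ≤ β) :
    ∃ N : ℕ, ∀ n : ℕ, N ≤ n → ∀ inj : Injections n, IsOfType inj ρ β →
      (adjustWindow n).LatencyAtMost inj
        ((18 * (n : ℝ) ^ 3 * Real.logb 2 n ^ 2 + 2 * β) / (1 - ρ)) := by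
  obtain ⟨i, hi⟩ := exists_doublings hρ1 β
  obtain ⟨N, hN⟩ := Filter.eventually_atTop.1 (eventually_initialLen_le (2 * 2 ^ i))
  refine ⟨N, fun n hn inj hinj r k p hp => ?_⟩
  obtain ⟨hn0, hle⟩ := hN n hn
  have hfits := fits_initialLen n
  obtain ⟨t, h1, h2, h3⟩ := latencyAtMost hfits hn0 hρ hinj
    (le_mainLen hfits hn0 (by linarith) hi) r k p hp
  refine ⟨t, h1, h2, h3.trans ?_⟩
  rw [le_div_iff₀ (by linarith)]
  have h4 : (0 : ℝ) ≤ 2 * 2 ^ i * initialLen n := by positivity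
  push_cast
  nlinarith

end MAC.AdjustWindow

theorem mainTheorem4 :
    (∀ n : ℕ, (MAC.adjustWindow n).IsPlainPacket) ∧
    (∀ n : ℕ, 3 ≤ n → ¬ (MAC.adjustWindow n).RoutesDirectly) ∧
    (∀ n : ℕ, (MAC.adjustWindow n).WorksWithEnergyCap 2) ∧
    (∀ n : ℕ, (MAC.adjustWindow n).IsUniversal) ∧
    (∀ ρ β : ℝ, 0 < ρ → ρ < 1 → 1 ≤ β →
      ∃ N : ℕ, ∀ n : ℕ, N ≤ n → ∀ inj : MAC.Injections n, MAC.IsOfType inj ρ β →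
        (MAC.adjustWindow n).LatencyAtMost inj
          ((18 * (n : ℝ) ^ 3 * Real.logb 2 n ^ 2 + 2 * β) / (1 - ρ))) :=
  ⟨fun n => MAC.AdjustWindow.isPlainPacket n _,
    fun n hn => MAC.AdjustWindow.not_routesDirectly (MAC.AdjustWindow.fits_initialLen n) hn,
    fun n => MAC.AdjustWindow.worksWithEnergyCap_two (MAC.AdjustWindow.fits_initialLen n),
    fun n => MAC.AdjustWindow.isUniversal (MAC.AdjustWindow.fits_initialLen n),
    fun _ _ hρ hρ1 hβ => MAC.AdjustWindow.exists_latencyAtMost hρ hρ1 hβ⟩
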